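/- Let $m,n\ge 1$ and $d\ge 0$ be integers. An *$m\times n$ net* is a family of points $P_{ij}\in\mathbb R^d$, $0\le i\le m$, $0\le j\le n$, such that $P_{ij},P_{i+1,j},P_{i+1,j+1},P_{i,j+1}$ are consecutive vertices of a (strictly) convex quadrilateral, called a *face*, for all $0\le i<m$, $0\le j<n$. An *L-shaped net of size $m\times n$* is a family of points $P_{ij}\in\mathbb R^d$ indexed only by the pairs with $0\le i\le m$, $0\le j\le n$, $\min\{i,j\}\le 1$, subject to the same requirement for those faces all of whose four vertices are in the family, i.e., for $i=0$, $0\le j<n$ and for $j=0$, $0\le i<m$. It is *contained* in an $m\times n$ net if the points with the same indices coincide. Edges are the sides of faces. An *L-shaped square net* is an L-shaped net whose faces are coplanar squares, no two of which coincide as subsets of $\mathbb R^d$. An $m\times n$ net $P$ is *deformable* if there is a continuous family $P(t)$, $t\in[0,1]$, of $m\times n$ nets with $P(0)=P$ such that for all $s,t$ corresponding edges of $P(s)$ and $P(t)$ are parallel and corresponding faces have equal areas, and for $s\ne t$ no isometry of $\mathbb R^d$ takes each point of $P(s)$ to the point of $P(t)$ with the same indices. Two quadrilaterals $ABCD$ and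 $ABC'D'$ are *affine symmetric with respect to the common side $AB$* if some affine map fixes the points of $AB$ and takes $C,D$ to $C',D'$. The *opposite ratio* of a convex quadrilateral $ABCD$ with respect to the side $AB$ is $\mathrm{Area}(AQB)/\mathrm{Area}(CQD)$, where $Q$ is the intersection point of the diagonals. Consider the following conditions on an L-shaped net. (i) Each two faces $P_{ij}P_{i+1,j}P_{i+1,j+1}P_{i,j+1}$ and $P_{i,j+1}P_{i+1,j+1}P_{i+1,j+2}P_{i,j+2}$ of the net are affine symmetric with respect to their common edge $P_{i,j+1}P_{i+1,j+1}$; or each two faces $P_{ij}P_{i+1,j}P_{i+1,j+1}P_{i,j+1}$ and $P_{i+1,j}P_{i+2,j}P_{i+2,j+1}P_{i+1,j+1}$ of the net are affine symmetric with respect to their common edge $P_{i+1,j}P_{i+1,j+1}$. (ii) Each two faces of the net with a common edge (one with common labels, as in (i)) have equal opposite ratios with respect to that edge. **Corollary.** For each L-shaped square net $S$ of size $m\times n$ there is $\varepsilon>0$ such that each L-shaped net $Q$ of size $m\times n$ which satisfies $|Q_{ij}-S_{ij}|<\varepsilon$ for all its indices $i,j$ and at least one of conditions (i), (ii) is contained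 in exactly one deformable $m\times n$ net. Moreover, this $m\times n$ net depends continuously on $Q$, where $Q$ runs over all such L-shaped nets. -/

import Mathlib

namespace LNet

/-- The ambient Euclidean space `ℝ^d`. -/
abbrev E (d : ℕ) := EuclideanSpace ℝ (Fin d)

/-! ### Elementary geometry of quadrilaterals in `ℝ^d` -/

/-- `A, B, C, D` are consecutive vertices of a (nondegenerate, strictly) convex quadrilateral:
the diagonals `AC` and `BD` meet at an interior point of both and are not collinear. -/
def ConvexQuad {d : ℕ} (A B C D : E d) : Prop :=
  AffineIndependent ℝ ![A, B, C] ∧ ∃ Q : E d, Sbtw ℝ A Q C ∧ Sbtw ℝ B Q D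

/-- Area of the triangle `ABC`: half the product of two sides and the sine of their angle. -/
noncomputable def triArea {d : ℕ} (A B C : E d) : ℝ :=
  dist A B * dist A C * Real.sin (EuclideanGeometry.angle B A C) / 2

/-- Area of a convex quadrilateral `ABCD`, cut along the diagonal `AC`. -/
noncomputable def quadArea {d : ℕ} (A B C D : E d) : ℝ :=
  triArea A B C + triArea A C D

/-- `r` is the opposite ratio of the quadrilateral `ABCD` with respect to the side `AB`:
the ratio of the areas of `AQB` and `CQD`, where `Q` is the common point of the diagonals. -/
def IsOppositeRatio {d : ℕ} (A B C D : E d) (r : ℝ) : Prop :=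
  ∃ Q : E d, Sbtw ℝ A Q C ∧ Sbtw ℝ B Q D ∧ r = triArea A Q B / triArea C Q D

/-- The quadrilaterals `ABCD` and `ABC'D'` have equal opposite ratios with respect to `AB`. -/
def EqualOppositeRatios {d : ℕ} (A B C D C' D' : E d) : Prop :=
  ∃ r : ℝ, IsOppositeRatio A B C D r ∧ IsOppositeRatio A B C' D' r

/-- The quadrilaterals `ABCD` and `ABC'D'` are affine symmetric with respect to the common side
`AB`: an affine map fixes (the points of) the segment `AB` and takes the first quadrilateral to the
second one (so it takes the other side at `B` to the other side at `B`, and likewise at `A`). -/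
def AffineSymmetric {d : ℕ} (A B C D C' D' : E d) : Prop :=
  ∃ f : E d →ᵃ[ℝ] E d, f A = A ∧ f B = B ∧ f C = C' ∧ f D = D'

/-- `ABCD` (consecutive vertices) is a square. -/
def IsSquare {d : ℕ} (A B C D : E d) : Prop :=
  A ≠ B ∧ B - A = C - D ∧ dist A B = dist A D ∧ inner ℝ (B - A) (D - A) = 0

/-! ### Nets over a set of indices

A net and an `L`-shaped net are both families of points indexed by a set `S` of pairs `(i, j)`;
the faces are the unit cells all of whose four corners belong to `S`. -/

/-- Indices of an `m × n` net. -/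
def gridIndex (m n : ℕ) : Set (ℕ × ℕ) := {p | p.1 ≤ m ∧ p.2 ≤ n}

/-- Indices of an `L`-shaped net of size `m × n`. -/
def lIndex (m n : ℕ) : Set (ℕ × ℕ) := {p | p.1 ≤ m ∧ p.2 ≤ n ∧ min p.1 p.2 ≤ 1}

theorem lIndex_subset_gridIndex (m n : ℕ) : lIndex m n ⊆ gridIndex m n :=
  fun _ hp => ⟨hp.1, hp.2.1⟩

/-- There is a face with corners `(i, j), (i+1, j), (i+1, j+1), (i, j+1)`. -/
def IsCell (S : Set (ℕ × ℕ)) (i j : ℕ) : Prop :=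
  (i, j) ∈ S ∧ (i + 1, j) ∈ S ∧ (i + 1, j + 1) ∈ S ∧ (i, j + 1) ∈ S

section Corners

variable {d : ℕ} {S : Set (ℕ × ℕ)} {i j : ℕ}

/-- The vertex `P_{i,j}` of the face `(i, j)`. -/
def v00 (P : S → E d) (h : IsCell S i j) : E d := P ⟨(i, j), h.1⟩

/-- The vertex `P_{i+1,j}` of the face `(i, j)`. -/
def v10 (P : S → E d) (h : IsCell S i j) : E d := P ⟨(i + 1, j), h.2.1⟩

/-- The vertex `P_{i+1,j+1}` of the face `(i, j)`. -/
def v11 (P : S → E d) (h : IsCell S i j) : E d := P ⟨(i + 1, j + 1), h.2.2.1⟩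

/-- The vertex `P_{i,j+1}` of the face `(i, j)`. -/
def v01 (P : S → E d) (h : IsCell S i j) : E d := P ⟨(i, j + 1), h.2.2.2⟩

end Corners

/-- `P` is a net over `S`: every face is a convex quadrilateral. For `S = gridIndex m n` this is
an `m × n` net, for `S = lIndex m n` it is an `L`-shaped net of size `m × n`. -/
def IsNet {d : ℕ} {S : Set (ℕ × ℕ)} (P : S → E d) : Prop :=
  ∀ (i j : ℕ) (h : IsCell S i j), ConvexQuad (v00 P h) (v10 P h) (v11 P h) (v01 P h)

/-- Corresponding edges of `P` and `P'` are parallel. -/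
def ParallelNets {d : ℕ} {S : Set (ℕ × ℕ)} (P P' : S → E d) : Prop :=
  (∀ (i j : ℕ) (h : (i, j) ∈ S) (h' : (i + 1, j) ∈ S),
    (affineSpan ℝ {P ⟨(i, j), h⟩, P ⟨(i + 1, j), h'⟩}).Parallel
      (affineSpan ℝ {P' ⟨(i, j), h⟩, P' ⟨(i + 1, j), h'⟩})) ∧
  (∀ (i j : ℕ) (h : (i, j) ∈ S) (h' : (i, j + 1) ∈ S),
    (affineSpan ℝ {P ⟨(i, j), h⟩, P ⟨(i, j + 1), h'⟩}).Parallel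
      (affineSpan ℝ {P' ⟨(i, j), h⟩, P' ⟨(i, j + 1), h'⟩}))

/-- Corresponding faces of `P` and `P'` have equal areas. -/
def EqualAreas {d : ℕ} {S : Set (ℕ × ℕ)} (P P' : S → E d) : Prop :=
  ∀ (i j : ℕ) (h : IsCell S i j),
    quadArea (v00 P h) (v10 P h) (v11 P h) (v01 P h) =
      quadArea (v00 P' h) (v10 P' h) (v11 P' h) (v01 P' h)

/-- An isometry of `ℝ^d` takes each point of `P` to the point of `P'` with the same indices. -/
def CongruentNets {d : ℕ} {S : Set (ℕ × ℕ)} (P P' : S → E d) : Prop :=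
  ∃ g : E d ≃ᵢ E d, ∀ p : S, g (P p) = P' p

/-- `P` is a deformable net: it is contained in (without loss of generality, is the initial member
of) a continuous family of pairwise non-congruent parallel nets with the same areas of
corresponding faces. -/
def IsDeformable {d : ℕ} {S : Set (ℕ × ℕ)} (P : S → E d) : Prop :=
  ∃ F : unitInterval → S → E d, Continuous F ∧ F 0 = P ∧ (∀ t, IsNet (F t)) ∧
    (∀ s t, ParallelNets (F s) (F t)) ∧ (∀ s t, EqualAreas (F s) (F t)) ∧
    ∀ s t, s ≠ t → ¬ CongruentNets (F s) (F t)

/-- Condition (i): in each `1 × 2` sub-net, or in each `2 × 1` sub-net, the two faces are affine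
symmetric with respect to their common edge. -/
def CondI {d : ℕ} {S : Set (ℕ × ℕ)} (P : S → E d) : Prop :=
  (∀ (i j : ℕ) (h : IsCell S i j) (h' : IsCell S i (j + 1)),
    AffineSymmetric (v01 P h) (v11 P h) (v10 P h) (v00 P h) (v11 P h') (v01 P h')) ∨
  (∀ (i j : ℕ) (h : IsCell S i j) (h' : IsCell S (i + 1) j),
    AffineSymmetric (v10 P h) (v11 P h) (v01 P h) (v00 P h) (v11 P h') (v10 P h'))

/-- Condition (ii): each pair of faces with a common edge has equal opposite ratios with respect
to that edge. -/
def CondII {d : ℕ} {S : Set (ℕ × ℕ)} (P : S → E d) : Prop :=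
  (∀ (i j : ℕ) (h : IsCell S i j) (h' : IsCell S i (j + 1)),
    EqualOppositeRatios (v01 P h) (v11 P h) (v10 P h) (v00 P h) (v11 P h') (v01 P h')) ∧
  (∀ (i j : ℕ) (h : IsCell S i j) (h' : IsCell S (i + 1) j),
    EqualOppositeRatios (v10 P h) (v11 P h) (v01 P h) (v00 P h) (v11 P h') (v10 P h'))

/-- The face `(i, j)` as a subset of `ℝ^d`. -/
def faceSet {d : ℕ} {S : Set (ℕ × ℕ)} {i j : ℕ} (P : S → E d) (h : IsCell S i j) : Set (E d) :=
  convexHull ℝ {v00 P h, v10 P h, v11 P h, v01 P h}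

/-- The faces are coplanar squares, and no two of them coincide. -/
def IsSquareNet {d : ℕ} {S : Set (ℕ × ℕ)} (P : S → E d) : Prop :=
  IsNet P ∧ Coplanar ℝ (Set.range P) ∧
  (∀ (i j : ℕ) (h : IsCell S i j), IsSquare (v00 P h) (v10 P h) (v11 P h) (v01 P h)) ∧
  ∀ (i j i' j' : ℕ) (h : IsCell S i j) (h' : IsCell S i' j'), (i, j) ≠ (i', j') →
    faceSet P h ≠ faceSet P h'

/-- The `L`-shaped part (first two rows and columns) of an `m × n` family of points. -/
def lPart {d m n : ℕ} (P : gridIndex m n → E d) : lIndex m n → E d :=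
  fun p => P ⟨p.1, lIndex_subset_gridIndex m n p.2⟩

/-- The `L`-shaped nets that are `ε`-close to `S` and satisfy condition (i) or (ii). -/
def admissible {d m n : ℕ} (S : lIndex m n → E d) (ε : ℝ) : Set (lIndex m n → E d) :=
  {Q | IsNet Q ∧ (∀ p, dist (Q p) (S p) < ε) ∧ (CondI Q ∨ CondII Q)}

end LNet

/-! Let the diagonals of a convex quadrilateral divide each other as `1 : ρσ` and `σ : ρ`. The
quadrilaterals with parallel, equally directed sides are, up to translation, obtained by stretching
the four sides by `p + c q` with `c = ρ, ρ⁻¹, -σ, -σ⁻¹`; the area is multiplied by `p² - q²`. So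
parallel quadrilaterals of the same area form, near the original one, a single curve `p = √(1 + q²)`
(`FaceParam.stretch_of_parallel`, `FaceParam.quadArea_deform`). Deforming a net means choosing a
parameter `q` for every face so that the stretchings agree on common edges.

Uniqueness. Non-congruence makes the stretching of the first edge differ from `1` at all small
nonzero times, so it serves as a local parameter `1 + z`, without any differentiability in time. The
relations on common edges then give every `q` an expansion `a z + b z² + o(z²)`. The stretchings of
the left and bottom edges of a face, known to second order, determine its `ρ, σ, a, b`
(`faceParam_eq_of_jets`). Hence the `L`-shaped part determines the parameters of all faces, and then
all points (`IsDeformable.eq_of_lPart_eq`). This argument needs no closeness to a square net.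

Existence. An affine symmetry in an edge inverts one parameter and keeps the other; equality of
opposite ratios only inverts the one. A single formula (`extRho`, `extSigma`) extends the parameters
from the `L` to the grid so that the pattern assumed on the `L` persists. Under (i), `q` can be
taken constant along each strip of symmetric faces; under (ii), equal for all faces
(`isDeformable_completion`). Points are then filled in face by face. For a square net all parameters
are `1` and the result is a square grid, so nearby nets also have nondegenerate completions. The
formula being continuous, so is the completion. -/

namespace LNet

open Filter Topology

/-! ### Gram determinants, independence and areas of triangles -/

/-- The Gram determinant of two vectors: the squared area of the parallelogram they span. -/
noncomputable def gramDet {d : ℕ} (u v : E d) : ℝ := ‖u‖ ^ 2 * ‖v‖ ^ 2 - (inner ℝ u v) ^ 2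

section Gram

variable {d : ℕ}

theorem gramDet_comb (u v : E d) (a b c e : ℝ) :
    gramDet (a • u + b • v) (c • u + e • v) = (a * e - b * c) ^ 2 * gramDet u v := by
  simp only [gramDet, ← real_inner_self_eq_norm_sq, inner_add_left, inner_add_right,
    real_inner_smul_left, real_inner_smul_right, real_inner_comm u v]
  ring

theorem gramDet_comm (u v : E d) : gramDet u v = gramDet v u := by
  simp only [gramDet, real_inner_comm u v]
  ring

theorem gramDet_nonneg (u v : E d) : 0 ≤ gramDet u v := by
  have h := real_inner_mul_inner_self_le u v
  simp only [real_inner_self_eq_norm_sq] at h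
  unfold gramDet
  nlinarith

theorem gramDet_smul_smul (u v : E d) (x y : ℝ) :
    gramDet (x • u) (y • v) = (x * y) ^ 2 * gramDet u v := by
  simpa using gramDet_comb u v x 0 0 y

theorem eq_zero_of_gramDet_pos {u v : E d} (h : 0 < gramDet u v) {a b : ℝ}
    (hab : a • u + b • v = 0) : a = 0 ∧ b = 0 := by
  have h1 := gramDet_comb u v a b 0 1
  have h2 := gramDet_comb u v a b 1 0
  rw [hab] at h1 h2
  have h0 : ∀ w : E d, gramDet 0 w = 0 := fun w => by simp [gramDet]
  rw [h0] at h1 h2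
  constructor
  · have : a ^ 2 * gramDet u v = 0 := by linarith
    simpa [h.ne'] using this
  · have : b ^ 2 * gramDet u v = 0 := by linarith
    simpa [h.ne'] using this

theorem comb_inj {u v : E d} (h : 0 < gramDet u v) {a b a' b' : ℝ}
    (hab : a • u + b • v = a' • u + b' • v) : a = a' ∧ b = b' := by
  have : (a - a') • u + (b - b') • v = 0 := by
    rw [sub_smul, sub_smul, ← sub_eq_zero.2 hab]; abel
  obtain ⟨h1, h2⟩ := eq_zero_of_gramDet_pos h this
  exact ⟨sub_eq_zero.1 h1, sub_eq_zero.1 h2⟩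

theorem ne_zero_of_gramDet_pos {u v : E d} (h : 0 < gramDet u v) : u ≠ 0 ∧ v ≠ 0 := by
  constructor <;> rintro rfl <;> simp [gramDet] at h

/-- The vector `‖v‖² u - ⟨u, v⟩ v` has squared norm `‖v‖²` times the Gram determinant. If the latter
vanishes, this is a linear relation, and it is nontrivial unless `v = 0`. -/
theorem linearIndependent_iff_gramDet_pos (u v : E d) :
    LinearIndependent ℝ ![u, v] ↔ 0 < gramDet u v := by
  rw [LinearIndependent.pair_iff]
  constructor
  · intro h
    refine lt_of_le_of_ne (gramDet_nonneg u v) fun h0 => ?_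
    have key : ‖(‖v‖ ^ 2) • u + (-(inner ℝ u v : ℝ)) • v‖ ^ 2 = ‖v‖ ^ 2 * gramDet u v := by
      simp only [gramDet, ← real_inner_self_eq_norm_sq, inner_add_left, inner_add_right,
        real_inner_smul_left, real_inner_smul_right, real_inner_comm u v]
      ring
    rw [← h0, mul_zero] at key
    have hv := (h _ _ (norm_eq_zero.1 (pow_eq_zero_iff (two_ne_zero) |>.1 key))).1
    have hv0 : v = 0 := by simpa using hv
    have := (h 0 1 (by simp [hv0])).2
    exact one_ne_zero this
  · intro h a b hab
    exact eq_zero_of_gramDet_pos h hab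

theorem affineIndependent_iff_gramDet_pos (A B C : E d) :
    AffineIndependent ℝ ![A, B, C] ↔ 0 < gramDet (B - A) (C - A) := by
  rw [affineIndependent_iff_linearIndependent_vsub ℝ _ (0 : Fin 3),
    ← linearIndependent_iff_gramDet_pos,
    ← linearIndependent_equiv (finSuccAboveEquiv (0 : Fin 3))]
  apply iff_of_eq
  congr 1
  ext i : 1
  fin_cases i <;> rfl

theorem triArea_eq (A B C : E d) : triArea A B C = √(gramDet (B - A) (C - A)) / 2 := by
  have h := InnerProductGeometry.sin_angle_mul_norm_mul_norm (B - A) (C - A)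
  rw [triArea, EuclideanGeometry.angle, vsub_eq_sub, vsub_eq_sub, dist_eq_norm', dist_eq_norm',
    gramDet]
  rw [real_inner_self_eq_norm_sq, real_inner_self_eq_norm_sq, ← pow_two] at h
  rw [← h]
  ring

theorem triArea_of_comb {A B C u v : E d} {a b c e : ℝ} (hB : B - A = a • u + b • v)
    (hC : C - A = c • u + e • v) : triArea A B C = |a * e - b * c| * (√(gramDet u v) / 2) := by
  rw [triArea_eq, hB, hC, gramDet_comb, Real.sqrt_mul (sq_nonneg _), Real.sqrt_sq_eq_abs]
  ring

end Gram

/-! ### Parameters of a convex quadrilateral -/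

/-- Parameters of a convex quadrilateral `ABCD`: the diagonals divide each other in the ratios
`1 : ρσ` and `σ : ρ`. -/
structure FaceParam {d : ℕ} (A B C D : E d) (ρ σ : ℝ) : Prop where
  rho_pos : 0 < ρ
  sigma_pos : 0 < σ
  gram_pos : 0 < gramDet (B - A) (D - A)
  rel : (ρ + σ) • (C - A) = ((1 + ρ * σ) * ρ) • (B - A) + ((1 + ρ * σ) * σ) • (D - A)

/-- The coordinate of `w` along `u` in the plane spanned by `u` and `v`. -/
noncomputable def coordFst {d : ℕ} (u v w : E d) : ℝ :=
  (inner ℝ w u * ‖v‖ ^ 2 - inner ℝ w v * inner ℝ u v) / gramDet u v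

/-- The first parameter of a convex quadrilateral. -/
noncomputable def rhoOf {d : ℕ} (A B C D : E d) : ℝ :=
  √((coordFst (B - A) (D - A) (C - A) + coordFst (D - A) (B - A) (C - A) - 1) *
    coordFst (B - A) (D - A) (C - A) / coordFst (D - A) (B - A) (C - A))

section Face

variable {d : ℕ} {A B C D : E d} {ρ σ : ℝ}

theorem coordFst_comb {u v : E d} (h : 0 < gramDet u v) (a b : ℝ) :
    coordFst u v (a • u + b • v) = a := by
  rw [coordFst, div_eq_iff h.ne']
  simp only [gramDet, inner_add_left, real_inner_smul_left, real_inner_self_eq_norm_sq,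
    real_inner_comm u v]
  ring

theorem FaceParam.sub_eq (h : FaceParam A B C D ρ σ) :
    C - A = ((1 + ρ * σ) * ρ / (ρ + σ)) • (B - A) + ((1 + ρ * σ) * σ / (ρ + σ)) • (D - A) := by
  have hs : ρ + σ ≠ 0 := (add_pos h.rho_pos h.sigma_pos).ne'
  rw [div_eq_inv_mul, div_eq_inv_mul, mul_smul, mul_smul _ (_ * σ), ← smul_add, ← h.rel, smul_smul,
    inv_mul_cancel₀ hs, one_smul]

theorem FaceParam.swap (h : FaceParam A B C D ρ σ) : FaceParam A D C B σ ρ where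
  rho_pos := h.sigma_pos
  sigma_pos := h.rho_pos
  gram_pos := by rw [gramDet_comm]; exact h.gram_pos
  rel := by rw [add_comm σ ρ, mul_comm σ ρ, h.rel, add_comm]

theorem FaceParam.rhoOf_eq (h : FaceParam A B C D ρ σ) : rhoOf A B C D = ρ := by
  have hρ := h.rho_pos
  have hσ := h.sigma_pos
  have h1 := coordFst_comb h.gram_pos ((1 + ρ * σ) * ρ / (ρ + σ)) ((1 + ρ * σ) * σ / (ρ + σ))
  have h2 := coordFst_comb h.swap.gram_pos ((1 + ρ * σ) * σ / (ρ + σ)) ((1 + ρ * σ) * ρ / (ρ + σ))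
  rw [← h.sub_eq] at h1
  rw [add_comm, ← h.sub_eq] at h2
  -- The coordinates `x, y` of `C - A` satisfy `x + y - 1 = ρσ` and `x / y = ρ / σ`, so the radicand
  -- is `ρ²`.
  rw [rhoOf, h1, h2, ← Real.sqrt_sq hρ.le]
  congr 1
  rw [Real.sqrt_sq hρ.le]
  field_simp
  ring

/-- Reflection of the labels in the midline joining the sides `BC` and `DA`. -/
theorem FaceParam.reflect (h : FaceParam A B C D ρ σ) : FaceParam D C B A ρ⁻¹ σ where
  rho_pos := inv_pos.2 h.rho_pos
  sigma_pos := h.sigma_pos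
  gram_pos := by
    have hρ := h.rho_pos
    have hσ := h.sigma_pos
    have h1 : C - D = ((1 + ρ * σ) * ρ / (ρ + σ)) • (B - A) +
        ((1 + ρ * σ) * σ / (ρ + σ) - 1) • (D - A) := by
      rw [sub_smul, ← add_sub_assoc, ← h.sub_eq]; simp
    have h2 : A - D = (0 : ℝ) • (B - A) + (-1 : ℝ) • (D - A) := by simp
    rw [h1, h2, gramDet_comb]
    have := h.gram_pos
    have : 0 < (1 + ρ * σ) * ρ / (ρ + σ) := by positivity
    have h3 : ((1 + ρ * σ) * ρ / (ρ + σ) * -1 - ((1 + ρ * σ) * σ / (ρ + σ) - 1) * 0) ^ 2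
      = ((1 + ρ * σ) * ρ / (ρ + σ)) ^ 2 := by ring
    rw [h3]
    positivity
  rel := by
    have hρ := h.rho_pos
    have hσ := h.sigma_pos
    have hs : 0 < ρ + σ := by positivity
    have h1 := h.sub_eq
    have h2 : C = A + (C - A) := by abel
    rw [h2, h1]
    match_scalars <;> field_simp <;> ring

/-- The two ratios in which the diagonals divide each other are arbitrary positive numbers, and
`ρσ`, `ρ/σ` are these ratios. -/
theorem convexQuad_iff : ConvexQuad A B C D ↔ ∃ ρ σ, FaceParam A B C D ρ σ := by
  constructor
  · rintro ⟨hA, Q, ⟨⟨k, ⟨hk0, hk1⟩, hk⟩, hQA, hQC⟩, ⟨l, ⟨hl0, hl1⟩, hl⟩, hQB, hQD⟩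
    rw [affineIndependent_iff_gramDet_pos] at hA
    have hk0' : 0 < k := lt_of_le_of_ne hk0 fun h => hQA (by simp [← hk, ← h])
    have hk1' : k < 1 := lt_of_le_of_ne hk1 fun h => hQC (by simp [← hk, h])
    have hl0' : 0 < l := lt_of_le_of_ne hl0 fun h => hQB (by simp [← hl, ← h])
    have hl1' : l < 1 := lt_of_le_of_ne hl1 fun h => hQD (by simp [← hl, h])
    rw [← hl, AffineMap.lineMap_apply, AffineMap.lineMap_apply] at hk
    simp only [vsub_eq_sub, vadd_eq_add] at hk
    have hC : C - A = ((1 - l) / k) • (B - A) + (l / k) • (D - A) := by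
      have h2 : k • (C - A) = (1 - l) • (B - A) + l • (D - A) := by
        have : k • (C - A) = (l • (D - B) + B) - A := by rw [← hk]; abel
        rw [this]; module
      rw [div_eq_inv_mul, div_eq_inv_mul, mul_smul, mul_smul, ← smul_add, ← h2, smul_smul,
        inv_mul_cancel₀ hk0'.ne', one_smul]
    have hg : 0 < gramDet (B - A) (D - A) := by
      have h1 := gramDet_comb (B - A) (D - A) 1 0 ((1 - l) / k) (l / k)
      rw [← hC] at h1
      simp only [one_smul, zero_smul, add_zero] at h1
      rw [h1] at hA
      exact pos_of_mul_pos_right hA (sq_nonneg _)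
    have h1l : 0 < 1 - l := by linarith
    have h1k : 0 < 1 - k := by linarith
    -- Here `a² = QC/AQ` and `b² = QD/BQ`, so `ρσ = a²` and `ρ/σ = b²` force `ρ = ab` and `σ = a/b`.
    obtain ⟨a, ha0, ha⟩ : ∃ a : ℝ, 0 < a ∧ a ^ 2 = (1 - k) / k :=
      ⟨√((1 - k) / k), Real.sqrt_pos.2 (by positivity), Real.sq_sqrt (by positivity)⟩
    obtain ⟨b, hb0, hb⟩ : ∃ b : ℝ, 0 < b ∧ b ^ 2 = (1 - l) / l :=
      ⟨√((1 - l) / l), Real.sqrt_pos.2 (by positivity), Real.sq_sqrt (by positivity)⟩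
    refine ⟨a * b, a / b, by positivity, by positivity, hg, ?_⟩
    rw [hC]
    have hk' : k = 1 / (1 + a ^ 2) := by rw [ha]; field_simp; ring
    have hl' : l = 1 / (1 + b ^ 2) := by rw [hb]; field_simp; ring
    rw [hk', hl']
    match_scalars <;> field_simp <;> ring
  · rintro ⟨ρ, σ, h⟩
    have hρ := h.rho_pos
    have hσ := h.sigma_pos
    have hAB : B - A ≠ 0 ∧ D - A ≠ 0 := ne_zero_of_gramDet_pos h.gram_pos
    have hC := h.sub_eq
    have hg : 0 < gramDet (B - A) (C - A) := by
      have h1 := gramDet_comb (B - A) (D - A) 1 0 ((1 + ρ * σ) * ρ / (ρ + σ))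
        ((1 + ρ * σ) * σ / (ρ + σ))
      rw [← hC] at h1
      simp only [one_smul, zero_smul, add_zero] at h1
      rw [h1]
      have := h.gram_pos
      simp only [one_mul, zero_mul, sub_zero]
      positivity
    have hAC := (ne_zero_of_gramDet_pos hg).2
    have hBD : B ≠ D := by
      rintro rfl
      have := h.gram_pos
      rw [gramDet, real_inner_self_eq_norm_sq] at this
      nlinarith
    refine ⟨(affineIndependent_iff_gramDet_pos _ _ _).2 hg,
      AffineMap.lineMap A C (1 / (1 + ρ * σ)), ?_, ?_⟩
    · rw [sbtw_lineMap_iff]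
      refine ⟨fun h => hAC (by simp [h]), by positivity, ?_⟩
      rw [div_lt_one (by positivity)]
      nlinarith [mul_pos hρ hσ]
    · have : (AffineMap.lineMap A C (1 / (1 + ρ * σ)) : E d) =
          AffineMap.lineMap B D (σ / (ρ + σ)) := by
        simp only [AffineMap.lineMap_apply, vsub_eq_sub, vadd_eq_add]
        rw [hC]
        match_scalars <;> field_simp <;> ring
      rw [this, sbtw_lineMap_iff]
      refine ⟨hBD, by positivity, ?_⟩
      rw [div_lt_one (by positivity)]
      linarith

theorem FaceParam.quadArea_eq (h : FaceParam A B C D ρ σ) :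
    quadArea A B C D = (1 + ρ * σ) * (√(gramDet (B - A) (D - A)) / 2) := by
  have hρ := h.rho_pos
  have hσ := h.sigma_pos
  have hB : B - A = (1 : ℝ) • (B - A) + (0 : ℝ) • (D - A) := by simp
  have hD : D - A = (0 : ℝ) • (B - A) + (1 : ℝ) • (D - A) := by simp
  rw [quadArea, triArea_of_comb hB h.sub_eq, triArea_of_comb h.sub_eq hD]
  simp only [one_mul, zero_mul, sub_zero, mul_zero, mul_one]
  rw [abs_of_pos (by positivity), abs_of_pos (by positivity)]
  field_simp
  ring

/-- The triangles `AQB` and `CQD` have equal angles at `Q`, so the ratio is `(AQ/QC)(BQ/QD) =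
(1/ρσ)(σ/ρ)`. -/
theorem FaceParam.eq_of_isOppositeRatio (h : FaceParam A B C D ρ σ) {r : ℝ}
    (hr : IsOppositeRatio A B C D r) : r = 1 / ρ ^ 2 := by
  obtain ⟨Q, ⟨⟨k, -, hk⟩, -⟩, ⟨⟨l, -, hl⟩, -⟩, rfl⟩ := hr
  have hρ := h.rho_pos
  have hσ := h.sigma_pos
  have hC := h.sub_eq
  have h1 : Q - A = k • (C - A) := by
    rw [← hk, AffineMap.lineMap_apply]; simp
  have h2 : Q - A = (1 - l) • (B - A) + l • (D - A) := by
    rw [← hl, AffineMap.lineMap_apply]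
    simp only [vsub_eq_sub, vadd_eq_add]
    module
  have hCA : k • (C - A) = (k * ((1 + ρ * σ) * ρ / (ρ + σ))) • (B - A) +
      (k * ((1 + ρ * σ) * σ / (ρ + σ))) • (D - A) := by
    rw [hC]; module
  have h3 : k = 1 / (1 + ρ * σ) := by
    rw [h1, hCA] at h2
    obtain ⟨e1, e2⟩ := comb_inj h.gram_pos h2
    rw [eq_div_iff (by positivity)]
    calc k * (1 + ρ * σ) = k * ((1 + ρ * σ) * ρ / (ρ + σ)) + k * ((1 + ρ * σ) * σ / (ρ + σ)) := by
          field_simp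
      _ = 1 := by linarith
  rw [hCA] at h1
  have hB : B - A = (1 : ℝ) • (B - A) + (0 : ℝ) • (D - A) := by simp
  have hQC : Q - C = (-((1 - k) * ((1 + ρ * σ) * ρ / (ρ + σ)))) • (B - A) +
      (-((1 - k) * ((1 + ρ * σ) * σ / (ρ + σ)))) • (D - A) := by
    have : Q - C = (Q - A) - (C - A) := by abel
    rw [this, h1, hC]; module
  have hDC : D - C = (-((1 + ρ * σ) * ρ / (ρ + σ))) • (B - A) +
      (1 - (1 + ρ * σ) * σ / (ρ + σ)) • (D - A) := by
    have : D - C = (D - A) - (C - A) := by abel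
    rw [this, hC]; module
  have hg : 0 < √(gramDet (B - A) (D - A)) := Real.sqrt_pos.2 h.gram_pos
  rw [triArea_of_comb h1 hB, triArea_of_comb hQC hDC]
  have e1 : k * ((1 + ρ * σ) * ρ / (ρ + σ)) * 0 - k * ((1 + ρ * σ) * σ / (ρ + σ)) * 1
      = - (σ / (ρ + σ)) := by rw [h3]; field_simp; ring
  have e2 : -((1 - k) * ((1 + ρ * σ) * ρ / (ρ + σ))) * (1 - (1 + ρ * σ) * σ / (ρ + σ)) -
      -((1 - k) * ((1 + ρ * σ) * σ / (ρ + σ))) * -((1 + ρ * σ) * ρ / (ρ + σ))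
      = - (ρ ^ 2 * σ / (ρ + σ)) := by rw [h3]; field_simp; ring
  rw [e1, e2, abs_neg, abs_neg, abs_of_pos (by positivity), abs_of_pos (by positivity)]
  field_simp

end Face

/-! ### Parallel deformations of one quadrilateral that preserve the area -/

/-- The factor by which a side is stretched in the equiareal parallel deformation of a convex
quadrilateral with parameter `q`; here `c` is one of `ρ`, `ρ⁻¹`, `-σ`, `-σ⁻¹`. -/
noncomputable def stretch (c q : ℝ) : ℝ := √(1 + q ^ 2) + c * q

theorem stretch_zero (c : ℝ) : stretch c 0 = 1 := by simp [stretch]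

theorem continuous_stretch (c : ℝ) : Continuous (stretch c) := by
  unfold stretch; fun_prop

/-- This exact form shows the expansion `c q + q²/2 + o(q²)`: the quadratic coefficient does not
depend on `c`. -/
theorem stretch_sub_one (c q : ℝ) :
    stretch c q - 1 = c * q + q ^ 2 / (√(1 + q ^ 2) + 1) := by
  have h : √(1 + q ^ 2) ^ 2 = 1 + q ^ 2 := Real.sq_sqrt (by positivity)
  have h' : 0 < √(1 + q ^ 2) + 1 := by positivity
  unfold stretch
  field_simp
  linear_combination h

theorem stretch_strictMonoOn {c : ℝ} (hc : 0 < c) : StrictMonoOn (stretch c) (Set.Ici 0) := by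
  intro a ha b hb hab
  have h0 : (0 : ℝ) ≤ a := ha
  unfold stretch
  have h1 : √(1 + a ^ 2) ≤ √(1 + b ^ 2) := Real.sqrt_le_sqrt (by nlinarith)
  have h2 : c * a < c * b := mul_lt_mul_of_pos_left hab hc
  linarith

section Deform

variable {d : ℕ} {A B C D A' B' C' D' : E d} {ρ σ q : ℝ}

/-- The identity is linear in `√(1 + q²)` and `q`. The coefficient of the former is a homothety;
that of the latter is the parallel variation with rates `ρ, ρ⁻¹, -σ, -σ⁻¹`. Both close up. -/
theorem FaceParam.closure (h : FaceParam A B C D ρ σ)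
    (hB : B' - A' = stretch ρ q • (B - A)) (hD : D' - A' = stretch (-σ) q • (D - A))
    (hC : C' - B' = stretch (-σ⁻¹) q • (C - B)) : C' - D' = stretch ρ⁻¹ q • (C - D) := by
  have hρ := h.rho_pos
  have hσ := h.sigma_pos
  have e1 : C' - D' = (C' - B') + (B' - A') - (D' - A') := by abel
  have e2 : C - B = (C - A) - (B - A) := by abel
  have e3 : C - D = (C - A) - (D - A) := by abel
  rw [e1, hB, hC, hD, e2, e3, h.sub_eq]
  simp only [stretch]
  match_scalars <;> field_simp <;> ring

theorem FaceParam.deform (h : FaceParam A B C D ρ σ)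
    (hB : B' - A' = stretch ρ q • (B - A)) (hD : D' - A' = stretch (-σ) q • (D - A))
    (hC : C' - B' = stretch (-σ⁻¹) q • (C - B))
    (hx : 0 < stretch ρ q) (ht : 0 < stretch ρ⁻¹ q)
    (hy : 0 < stretch (-σ) q) (hs : 0 < stretch (-σ⁻¹) q) :
    FaceParam A' B' C' D' (ρ * stretch ρ⁻¹ q / stretch ρ q)
      (σ * stretch (-σ⁻¹) q / stretch (-σ) q) := by
  have hρ := h.rho_pos
  have hσ := h.sigma_pos
  refine ⟨by positivity, by positivity, ?_, ?_⟩
  · rw [hB, hD, gramDet_smul_smul]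
    have := h.gram_pos
    positivity
  · have e1 : C' - A' = (C' - B') + (B' - A') := by abel
    have e2 : C - B = (C - A) - (B - A) := by abel
    have hp : √(1 + q ^ 2) ^ 2 = 1 + q ^ 2 := Real.sq_sqrt (by positivity)
    rw [e1, hC, hD, hB, e2, h.sub_eq]
    simp only [stretch] at *
    set p := √(1 + q ^ 2)
    have hx' := hx.ne'
    have hy' := hy.ne'
    generalize hX : p + ρ * q = X at *
    generalize hT : p + ρ⁻¹ * q = T at *
    generalize hY : p + -σ * q = Y at *
    generalize hS : p + -σ⁻¹ * q = S at *
    have hT' : ρ * T = ρ * p + q := by rw [← hT]; field_simp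
    have hS' : σ * S = σ * p - q := by rw [← hS]; field_simp; ring
    -- Both identities come from `p² - q² = 1`; they give the product and the sum of the new
    -- parameters over the common denominator `X Y`.
    have key : X * Y + ρ * T * (σ * S) = 1 + ρ * σ := by
      rw [hT', hS', ← hX, ← hY]; linear_combination (1 + ρ * σ) * hp
    have key2 : ρ * T * Y + σ * S * X = ρ + σ := by
      rw [hT', hS', ← hX, ← hY]; linear_combination (ρ + σ) * hp
    have k1 : ρ * T / X + σ * S / Y = (ρ + σ) / (X * Y) := by
      rw [← key2]; field_simp
    have k2 : 1 + ρ * T / X * (σ * S / Y) = (1 + ρ * σ) / (X * Y) := by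
      rw [← key]; field_simp
    rw [k1, k2]
    have k3 : S * ((1 + ρ * σ) * ρ - (ρ + σ)) + X * (ρ + σ) = (1 + ρ * σ) * (ρ * T) := by
      have : σ * (S * ((1 + ρ * σ) * ρ - (ρ + σ)) + X * (ρ + σ)) = σ * ((1 + ρ * σ) * (ρ * T)) := by
        have : σ * (S * ((1 + ρ * σ) * ρ - (ρ + σ)) + X * (ρ + σ)) =
          (σ * S) * ((1 + ρ * σ) * ρ - (ρ + σ)) + σ * X * (ρ + σ) := by ring
        rw [this, hT', hS', ← hX]; ring
      exact mul_left_cancel₀ hσ.ne' this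
    generalize B - A = u
    generalize D - A = w
    match_scalars
    · field_simp
      linear_combination k3
    · field_simp

theorem FaceParam.quadArea_deform (h : FaceParam A B C D ρ σ)
    (hB : B' - A' = stretch ρ q • (B - A)) (hD : D' - A' = stretch (-σ) q • (D - A))
    (hC : C' - B' = stretch (-σ⁻¹) q • (C - B))
    (hx : 0 < stretch ρ q) (ht : 0 < stretch ρ⁻¹ q)
    (hy : 0 < stretch (-σ) q) (hs : 0 < stretch (-σ⁻¹) q) :
    quadArea A' B' C' D' = quadArea A B C D := by
  have hρ := h.rho_pos
  have hσ := h.sigma_pos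
  rw [(h.deform hB hD hC hx ht hy hs).quadArea_eq, h.quadArea_eq, hB, hD, gramDet_smul_smul,
    Real.sqrt_mul (sq_nonneg _), Real.sqrt_sq (by positivity)]
  have hp : √(1 + q ^ 2) ^ 2 = 1 + q ^ 2 := Real.sq_sqrt (by positivity)
  have key : stretch ρ q * stretch (-σ) q + ρ * stretch ρ⁻¹ q * (σ * stretch (-σ⁻¹) q) =
      1 + ρ * σ := by
    unfold stretch
    field_simp
    linear_combination (1 + ρ * σ) * hp
  rw [← key]
  field_simp

/-- A parallel quadrilateral of the same area belongs to the one-parameter family. -/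
theorem FaceParam.stretch_of_parallel (h : FaceParam A B C D ρ σ) {x y s t : ℝ}
    (hB : B' - A' = x • (B - A)) (hD : D' - A' = y • (D - A))
    (hC : C' - B' = s • (C - B)) (hC' : C' - D' = t • (C - D))
    (hx : 0 < x) (hy : 0 < y) (hs : 0 < s) (ht : 0 < t)
    (hp : 0 < x - ρ * ((x - y) / (ρ + σ)))
    (harea : quadArea A' B' C' D' = quadArea A B C D) :
    x = stretch ρ ((x - y) / (ρ + σ)) ∧ t = stretch ρ⁻¹ ((x - y) / (ρ + σ)) ∧
      y = stretch (-σ) ((x - y) / (ρ + σ)) ∧ s = stretch (-σ⁻¹) ((x - y) / (ρ + σ)) := by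
  have hρ := h.rho_pos
  have hσ := h.sigma_pos
  have hC0 := h.sub_eq
  set lam := (1 + ρ * σ) * ρ / (ρ + σ) with hlam
  set mu := (1 + ρ * σ) * σ / (ρ + σ) with hmu
  have hlam0 : 0 < lam := by positivity
  have hmu0 : 0 < mu := by positivity
  have e1 : C' - A' = (x + s * (lam - 1)) • (B - A) + (s * mu) • (D - A) := by
    have e1 : C' - A' = (C' - B') + (B' - A') := by abel
    have e2 : C - B = (C - A) - (B - A) := by abel
    rw [e1, hC, hB, e2, hC0]; module
  have e2 : C' - A' = (t * lam) • (B - A) + (y + t * (mu - 1)) • (D - A) := by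
    have e1 : C' - A' = (C' - D') + (D' - A') := by abel
    have e2 : C - D = (C - A) - (D - A) := by abel
    rw [e1, hC', hD, e2, hC0]; module
  obtain ⟨c1, c2⟩ := comb_inj h.gram_pos (e1.symm.trans e2)
  have e3 : C' - A' = (t * lam) • (B - A) + (s * mu) • (D - A) := by rw [e1, c1]
  have eB : B' - A' = x • (B - A) + (0 : ℝ) • (D - A) := by rw [hB]; simp
  have eD : D' - A' = (0 : ℝ) • (B - A) + y • (D - A) := by rw [hD]; simp
  have hg : 0 < √(gramDet (B - A) (D - A)) := Real.sqrt_pos.2 h.gram_pos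
  rw [h.quadArea_eq, quadArea, triArea_of_comb eB e3, triArea_of_comb e3 eD, ← add_mul] at harea
  have harea := mul_right_cancel₀ (by positivity) harea
  rw [zero_mul, sub_zero, mul_zero, sub_zero, abs_of_pos (by positivity),
    abs_of_pos (by positivity)] at harea
  -- Closing up is two linear equations on four factors, so a plane of solutions remains. The
  -- coordinates `p, q` are read off from `x = p + ρ q` and `y = p - σ q`; `t` and `s` then follow.
  set q := (x - y) / (ρ + σ) with hq
  set p := x - ρ * q with hpdef
  have hsum : (ρ + σ) * q = x - y := by rw [hq]; field_simp
  have hx' : x = p + ρ * q := by rw [hpdef]; ring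
  have hy' : y = p - σ * q := by rw [hpdef]; linear_combination hsum
  have l1 : lam + mu = 1 + ρ * σ := by rw [hlam, hmu]; field_simp
  have l2 : lam * σ = mu * ρ := by rw [hlam, hmu]; ring
  have hl : lam * (ρ + σ) = (1 + ρ * σ) * ρ := by rw [hlam]; field_simp
  have ht' : ρ * t = ρ * p + q := by
    have hst : t * (lam * mu - (lam - 1) * (mu - 1)) = mu * x + (lam - 1) * y := by
      linear_combination (-mu) * c1 + (lam - 1) * c2
    have h5 : lam * mu - (lam - 1) * (mu - 1) = ρ * σ := by linear_combination l1
    rw [h5, hx', hy'] at hst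
    have : σ * (ρ * t) = σ * (ρ * p + q) := by
      linear_combination hst + p * l1 + q * (-l2)
    exact mul_left_cancel₀ hσ.ne' this
  have hs' : σ * s = σ * p - q := by
    have hst : s * (lam * mu - (lam - 1) * (mu - 1)) = lam * y + (mu - 1) * x := by
      linear_combination lam * c2 - (mu - 1) * c1
    have h5 : lam * mu - (lam - 1) * (mu - 1) = ρ * σ := by linear_combination l1
    rw [h5, hx', hy'] at hst
    have : ρ * (σ * s) = ρ * (σ * p - q) := by
      linear_combination hst + p * l1 - q * l2
    exact mul_left_cancel₀ hρ.ne' this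
  -- The area is multiplied by `p² - q²`.
  have hpq : p ^ 2 = 1 + q ^ 2 := by
    have h6 : (ρ + σ) * (x * (s * mu) + t * lam * y) = (ρ + σ) * (1 + ρ * σ) := by rw [harea]
    have hm : mu * (ρ + σ) = (1 + ρ * σ) * σ := by rw [hmu]; field_simp
    have h7 : (1 + ρ * σ) * (x * (σ * s) + ρ * t * y) = (1 + ρ * σ) * (ρ + σ) := by
      linear_combination h6 - x * s * hm - t * y * hl
    have h8 := mul_left_cancel₀ (by positivity) h7
    rw [ht', hs', hx', hy'] at h8
    have h9 : (ρ + σ) * p ^ 2 = (ρ + σ) * (1 + q ^ 2) := by linear_combination h8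
    exact mul_left_cancel₀ (by positivity) h9
  -- Positivity of `p` selects the branch of the hyperbola through the undeformed quadrilateral.
  have hsq : √(1 + q ^ 2) = p := by rw [← hpq, Real.sqrt_sq hp.le]
  unfold stretch
  rw [hsq]
  refine ⟨hx', ?_, by rw [hy']; ring, ?_⟩
  · field_simp; linarith
  · field_simp; linarith

end Deform

/-! ### Continuity of the face parameters -/

theorem continuousAt_gramDet {X : Type*} [TopologicalSpace X] {d : ℕ} {u v : X → E d} {x : X}
    (hu : ContinuousAt u x) (hv : ContinuousAt v x) :
    ContinuousAt (fun y => gramDet (u y) (v y)) x := by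
  unfold gramDet
  exact ((hu.norm.pow 2).mul (hv.norm.pow 2)).sub ((hu.inner (𝕜 := ℝ) hv).pow 2)

theorem continuousAt_coordFst {X : Type*} [TopologicalSpace X] {d : ℕ} {u v w : X → E d} {x : X}
    (hu : ContinuousAt u x) (hv : ContinuousAt v x) (hw : ContinuousAt w x)
    (h : 0 < gramDet (u x) (v x)) :
    ContinuousAt (fun y => coordFst (u y) (v y) (w y)) x := by
  unfold coordFst
  exact (((hw.inner (𝕜 := ℝ) hu).mul (hv.norm.pow 2)).sub ((hw.inner (𝕜 := ℝ) hv).mul (hu.inner (𝕜 := ℝ) hv))).div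
    (continuousAt_gramDet hu hv) h.ne'

theorem continuousAt_rhoOf {X : Type*} [TopologicalSpace X] {d : ℕ} {A B C D : X → E d} {x : X}
    (hA : ContinuousAt A x) (hB : ContinuousAt B x) (hC : ContinuousAt C x)
    (hD : ContinuousAt D x) {ρ σ : ℝ} (h : FaceParam (A x) (B x) (C x) (D x) ρ σ) :
    ContinuousAt (fun y => rhoOf (A y) (B y) (C y) (D y)) x := by
  have h1 := continuousAt_coordFst (hB.sub hA) (hD.sub hA) (hC.sub hA) h.gram_pos
  have h2 := continuousAt_coordFst (hD.sub hA) (hB.sub hA) (hC.sub hA) h.swap.gram_pos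
  have hρ := h.rho_pos
  have hσ := h.sigma_pos
  unfold rhoOf
  refine Real.continuous_sqrt.continuousAt.comp
    ((((h1.add h2).sub continuousAt_const).mul h1).div h2 ?_)
  rw [h.swap.sub_eq, coordFst_comb h.swap.gram_pos]
  positivity

/-! ### Second-order expansions along a filter -/

/-- `f = a z + b z ^ 2 + o(z ^ 2)` along the filter `l`. -/
def HasJet {T : Type*} (l : Filter T) (z f : T → ℝ) (a b : ℝ) : Prop :=
  Tendsto (fun τ => (f τ - a * z τ) / z τ ^ 2) l (𝓝 b)

section Jet

variable {T : Type*} {l : Filter T} {z f q : T → ℝ} {a b c : ℝ}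

theorem HasJet.congr' {g : T → ℝ} (h : HasJet l z f a b) (hfg : f =ᶠ[l] g) : HasJet l z g a b :=
  Tendsto.congr' (hfg.mono fun τ hτ => by simp only [hτ]) h

theorem hasJet_self (z : T → ℝ) : HasJet l z z 1 0 := by
  simp [HasJet, tendsto_const_nhds]

theorem HasJet.tendsto_div (h : HasJet l z f a b) (hz : Tendsto z l (𝓝 0))
    (hz0 : ∀ᶠ τ in l, z τ ≠ 0) : Tendsto (fun τ => f τ / z τ) l (𝓝 a) := by
  have h1 := (Tendsto.mul h hz).const_add a
  rw [mul_zero, add_zero] at h1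
  refine h1.congr' (hz0.mono fun τ hτ => ?_)
  simp only
  field_simp
  ring

theorem HasJet.unique [NeBot l] {a' b' : ℝ} (h : HasJet l z f a b) (h' : HasJet l z f a' b')
    (hz : Tendsto z l (𝓝 0)) (hz0 : ∀ᶠ τ in l, z τ ≠ 0) : a = a' ∧ b = b' := by
  obtain rfl := tendsto_nhds_unique (h.tendsto_div hz hz0) (h'.tendsto_div hz hz0)
  exact ⟨rfl, tendsto_nhds_unique h h'⟩

theorem tendsto_sqrt_one_add_sq (hq : Tendsto q l (𝓝 0)) :
    Tendsto (fun τ => √(1 + q τ ^ 2) + 1) l (𝓝 2) := by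
  have h : Continuous fun x : ℝ => √(1 + x ^ 2) + 1 := by fun_prop
  have h2 : √(1 + (0 : ℝ) ^ 2) + 1 = 2 := by norm_num
  have := (h.tendsto 0).comp hq
  rwa [h2] at this

theorem HasJet.stretch (hq : Tendsto q l (𝓝 0)) (hz : Tendsto z l (𝓝 0))
    (hz0 : ∀ᶠ τ in l, z τ ≠ 0) (h : HasJet l z q a b) (c : ℝ) :
    HasJet l z (fun τ => stretch c (q τ) - 1) (c * a) (c * b + a ^ 2 / 2) := by
  have h1 := (Tendsto.const_mul c h).add
    (((h.tendsto_div hz hz0).pow 2).div (tendsto_sqrt_one_add_sq hq) two_ne_zero)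
  refine Tendsto.congr' (hz0.mono fun τ hτ => ?_) h1
  have h' : 0 < √(1 + q τ ^ 2) + 1 := by positivity
  simp only [stretch_sub_one, Pi.div_apply]
  field_simp
  ring

/-- Expansions can be inverted through `stretch c`, because its linear coefficient `c` is nonzero.
-/
theorem HasJet.of_stretch (hc : c ≠ 0) (hq : Tendsto q l (𝓝 0)) (hz : Tendsto z l (𝓝 0))
    (hz0 : ∀ᶠ τ in l, z τ ≠ 0) (h : HasJet l z (fun τ => LNet.stretch c (q τ) - 1) a b) :
    HasJet l z q (a / c) ((b - (a / c) ^ 2 / 2) / c) := by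
  have hp := tendsto_sqrt_one_add_sq hq
  -- By `stretch_sub_one`, `stretch c q - 1` is `q` times this factor.
  have hm : Tendsto (fun τ => c + q τ / (√(1 + q τ ^ 2) + 1)) l (𝓝 c) := by
    simpa using (hq.div hp two_ne_zero).const_add c
  have hdiv : Tendsto (fun τ => q τ / z τ) l (𝓝 (a / c)) := by
    refine ((h.tendsto_div hz hz0).div hm hc).congr' ?_
    filter_upwards [hz0, hm.eventually_ne hc] with τ hτ hτ'
    simp only [stretch_sub_one, Pi.div_apply]
    rw [div_div, div_eq_div_iff (mul_ne_zero hτ hτ') hτ]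
    ring
  have h1 := (Tendsto.sub h ((hdiv.pow 2).div hp two_ne_zero)).div_const c
  refine Tendsto.congr' (hz0.mono fun τ hτ => ?_) h1
  have h' : 0 < √(1 + q τ ^ 2) + 1 := by positivity
  simp only [stretch_sub_one, Pi.div_apply]
  field_simp
  ring

end Jet

/-! ### Propagation of the expansions from face to face -/

/-- The 2-jets `(a, b)` of the deformation parameters of all faces of a net with face parameters
`ρ, σ`, relative to the stretching of the first edge. -/
structure IsJetField (m n : ℕ) (ρ σ a b : ℕ → ℕ → ℝ) : Prop where
  rho_pos : ∀ i < m, ∀ j < n, 0 < ρ i j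
  sigma_pos : ∀ i < m, ∀ j < n, 0 < σ i j
  base_fst : ρ 0 0 * a 0 0 = 1
  base_snd : ρ 0 0 * b 0 0 + a 0 0 ^ 2 / 2 = 0
  vert : ∀ i < m, ∀ j, j + 1 < n →
    (ρ i j)⁻¹ * a i j = ρ i (j + 1) * a i (j + 1) ∧
    (ρ i j)⁻¹ * b i j + a i j ^ 2 / 2 = ρ i (j + 1) * b i (j + 1) + a i (j + 1) ^ 2 / 2
  horiz : ∀ i, i + 1 < m → ∀ j < n,
    -(σ i j)⁻¹ * a i j = -σ (i + 1) j * a (i + 1) j ∧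
    -(σ i j)⁻¹ * b i j + a i j ^ 2 / 2 = -σ (i + 1) j * b (i + 1) j + a (i + 1) j ^ 2 / 2

/-- First-order terms fix the ratio `ρ : σ`. Combining the second-order terms with weights `σ` and
`ρ` eliminates `b` and leaves `(ρ + σ) a² / 2`, so `a²` is determined. The sign of `a` is that of `ρ
a`, and the rest follows by division. -/
theorem faceParam_eq_of_jets {ρ σ a b ρ' σ' a' b' : ℝ} (hρ : 0 < ρ) (hρ' : 0 < ρ') (hσ' : 0 < σ')
    (ha : a ≠ 0) (h1 : ρ * a = ρ' * a') (h2 : ρ * b + a ^ 2 / 2 = ρ' * b' + a' ^ 2 / 2)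
    (h3 : -σ * a = -σ' * a') (h4 : -σ * b + a ^ 2 / 2 = -σ' * b' + a' ^ 2 / 2) (hσ : 0 < σ) :
    ρ = ρ' ∧ σ = σ' ∧ a = a' ∧ b = b' := by
  have hk : σ * ρ' = ρ * σ' := by
    have : a * (σ * ρ') = a * (ρ * σ') := by
      linear_combination (-σ') * h1 - ρ' * h3
    exact mul_left_cancel₀ ha this
  have hsq : a ^ 2 = a' ^ 2 := by
    have : (ρ + σ) * a ^ 2 = (ρ + σ) * a' ^ 2 := by
      linear_combination 2 * σ * h2 + 2 * ρ * h4 + 2 * b' * hk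
    exact mul_left_cancel₀ (by positivity) this
  have haa : a = a' := by
    rcases sq_eq_sq_iff_eq_or_eq_neg.1 hsq with h | h
    · exact h
    · exfalso
      rw [h] at h1 ha
      have : a' * (ρ + ρ') = 0 := by linear_combination -h1
      rcases mul_eq_zero.1 this with h0 | h0
      · exact ha (by simp [h0])
      · linarith
  subst haa
  have hr : ρ = ρ' := mul_right_cancel₀ ha h1
  have hs : σ = σ' := by
    have := mul_right_cancel₀ ha h3
    linarith
  subst hr hs
  refine ⟨rfl, rfl, rfl, mul_left_cancel₀ hρ.ne' ?_⟩
  linarith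

theorem jet_eq {c a b a' b' : ℝ} (hc : c ≠ 0) (h1 : c * a = c * a')
    (h2 : c * b + a ^ 2 / 2 = c * b' + a' ^ 2 / 2) : a = a' ∧ b = b' := by
  have h := mul_left_cancel₀ hc h1
  subst h
  exact ⟨rfl, mul_left_cancel₀ hc (by linarith)⟩

/-- The face parameters on the `L`-shaped part determine all face parameters. -/
theorem IsJetField.eq {m n : ℕ} {ρ σ a b ρ' σ' a' b' : ℕ → ℕ → ℝ}
    (h : IsJetField m n ρ σ a b) (h' : IsJetField m n ρ' σ' a' b')
    (hL : ∀ i < m, ∀ j < n, i = 0 ∨ j = 0 → ρ i j = ρ' i j ∧ σ i j = σ' i j) :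
    ∀ i < m, ∀ j < n, ρ i j = ρ' i j ∧ σ i j = σ' i j := by
  have key : ∀ i, i < m → ∀ j, j < n → a i j ≠ 0 ∧ ρ i j = ρ' i j ∧ σ i j = σ' i j ∧
      a i j = a' i j ∧ b i j = b' i j := by
    intro i
    induction i with
    | zero =>
      intro hi j
      induction j with
      | zero =>
        intro hj
        obtain ⟨e1, e2⟩ := hL 0 hi 0 hj (Or.inl rfl)
        have h1 := h.base_fst
        have h2 := h.base_snd
        have h1' := h'.base_fst
        have h2' := h'.base_snd
        rw [← e1] at h1' h2'
        have := jet_eq (h.rho_pos 0 hi 0 hj).ne' (h1.trans h1'.symm) (h2.trans h2'.symm)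
        refine ⟨?_, e1, e2, this⟩
        intro h0
        simp [h0] at h1
      | succ j ih =>
        intro hj
        obtain ⟨i1, i2, i3, i4, i5⟩ := ih (by omega)
        obtain ⟨e1, e2⟩ := hL 0 hi (j + 1) hj (Or.inl rfl)
        obtain ⟨f1, f2⟩ := h.vert 0 hi j hj
        obtain ⟨f1', f2'⟩ := h'.vert 0 hi j hj
        rw [← i2, ← i4, ← e1] at f1'
        rw [← i2, ← i4, ← i5, ← e1] at f2'
        have := jet_eq (h.rho_pos 0 hi (j + 1) hj).ne' (f1.symm.trans f1') (f2.symm.trans f2')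
        refine ⟨?_, e1, e2, this⟩
        intro h0
        rw [h0, mul_zero] at f1
        exact (mul_ne_zero (inv_ne_zero (h.rho_pos 0 hi j (by omega)).ne') i1) f1
    | succ i ihi =>
      intro hi j
      induction j with
      | zero =>
        intro hj
        obtain ⟨i1, i2, i3, i4, i5⟩ := ihi (by omega) 0 hj
        obtain ⟨e1, e2⟩ := hL (i + 1) hi 0 hj (Or.inr rfl)
        obtain ⟨f1, f2⟩ := h.horiz i hi 0 hj
        obtain ⟨f1', f2'⟩ := h'.horiz i hi 0 hj
        rw [← i3, ← i4, ← e2] at f1'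
        rw [← i3, ← i4, ← i5, ← e2] at f2'
        have hσ := h.sigma_pos (i + 1) hi 0 hj
        have := jet_eq (neg_ne_zero.2 hσ.ne') (f1.symm.trans f1') (f2.symm.trans f2')
        refine ⟨?_, e1, e2, this⟩
        intro h0
        rw [h0, mul_zero] at f1
        exact (mul_ne_zero (neg_ne_zero.2 (inv_ne_zero (h.sigma_pos i (by omega) 0 hj).ne')) i1) f1
      | succ j ih =>
        intro hj
        obtain ⟨i1, i2, i3, i4, i5⟩ := ihi (by omega) (j + 1) hj
        obtain ⟨j1, j2, j3, j4, j5⟩ := ih (by omega)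
        obtain ⟨f1, f2⟩ := h.horiz i hi (j + 1) hj
        obtain ⟨f1', f2'⟩ := h'.horiz i hi (j + 1) hj
        rw [← i3, ← i4] at f1'
        rw [← i3, ← i4, ← i5] at f2'
        obtain ⟨g1, g2⟩ := h.vert (i + 1) hi j hj
        obtain ⟨g1', g2'⟩ := h'.vert (i + 1) hi j hj
        rw [← j2, ← j4] at g1'
        rw [← j2, ← j4, ← j5] at g2'
        have ha : a (i + 1) (j + 1) ≠ 0 := by
          intro h0
          rw [h0, mul_zero] at g1
          exact (mul_ne_zero (inv_ne_zero (h.rho_pos (i + 1) hi j (by omega)).ne') j1) g1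
        -- An inner face shares its bottom and left edges with faces already treated, so four
        -- quantities are known for its four unknowns.
        exact ⟨ha, faceParam_eq_of_jets (h.rho_pos _ hi _ hj) (h'.rho_pos _ hi _ hj)
          (h'.sigma_pos _ hi _ hj) ha (g1.symm.trans g1') (g2.symm.trans g2')
          (f1.symm.trans f1') (f2.symm.trans f2') (h.sigma_pos _ hi _ hj)⟩
  intro i hi j hj
  obtain ⟨-, h1, h2, -⟩ := key i hi j hj
  exact ⟨h1, h2⟩

/-- The stretching factors `h, v` of the edges come from parameters `q` of the faces. -/
structure CellRel (ρ σ : ℕ → ℕ → ℝ) (h v q : ℕ → ℕ → ℝ) (i j : ℕ) : Prop where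
  bottom : h i j = stretch (ρ i j) (q i j)
  top : h i (j + 1) = stretch (ρ i j)⁻¹ (q i j)
  left : v i j = stretch (-σ i j) (q i j)
  right : v (i + 1) j = stretch (-(σ i j)⁻¹) (q i j)

/-- No regularity in `τ` is needed: every `q` is expanded in powers of `z`, the change of the first
edge, instead of in the time. -/
theorem exists_isJetField {T : Type*} {l : Filter T} [NeBot l] {m n : ℕ} (hm : 1 ≤ m) (hn : 1 ≤ n)
    {ρ σ : ℕ → ℕ → ℝ} {h v q : T → ℕ → ℕ → ℝ}
    (hρ : ∀ i < m, ∀ j < n, 0 < ρ i j) (hσ : ∀ i < m, ∀ j < n, 0 < σ i j)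
    (hq : ∀ i < m, ∀ j < n, Tendsto (fun τ => q τ i j) l (𝓝 0))
    (hrel : ∀ᶠ τ in l, ∀ i < m, ∀ j < n, CellRel ρ σ (h τ) (v τ) (q τ) i j)
    (hne : ∀ᶠ τ in l, h τ 0 0 ≠ 1) :
    ∃ a b, IsJetField m n ρ σ a b := by
  set z : T → ℝ := fun τ => h τ 0 0 - 1 with hzdef
  have hz : Tendsto z l (𝓝 0) := by
    have h1 := (((continuous_stretch (ρ 0 0)).tendsto 0).comp (hq 0 hm 0 hn)).sub_const 1
    rw [stretch_zero, sub_self] at h1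
    exact h1.congr' (hrel.mono fun τ hτ => by simp [hzdef, (hτ 0 hm 0 hn).bottom])
  have hz0 : ∀ᶠ τ in l, z τ ≠ 0 := hne.mono fun τ hτ => sub_ne_zero.2 hτ
  have hB : ∀ i < m, ∀ j < n, (fun τ => stretch (ρ i j) (q τ i j) - 1) =ᶠ[l]
      fun τ => h τ i j - 1 := fun i hi j hj => hrel.mono fun τ hτ => by
    simp only [(hτ i hi j hj).bottom]
  have hT : ∀ i < m, ∀ j < n, (fun τ => stretch (ρ i j)⁻¹ (q τ i j) - 1) =ᶠ[l]
      fun τ => h τ i (j + 1) - 1 := fun i hi j hj => hrel.mono fun τ hτ => by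
    simp only [(hτ i hi j hj).top]
  have hLf : ∀ i < m, ∀ j < n, (fun τ => stretch (-σ i j) (q τ i j) - 1) =ᶠ[l]
      fun τ => v τ i j - 1 := fun i hi j hj => hrel.mono fun τ hτ => by
    simp only [(hτ i hi j hj).left]
  have hR : ∀ i < m, ∀ j < n, (fun τ => stretch (-(σ i j)⁻¹) (q τ i j) - 1) =ᶠ[l]
      fun τ => v τ (i + 1) j - 1 := fun i hi j hj => hrel.mono fun τ hτ => by
    simp only [(hτ i hi j hj).right]
  have key : ∀ i j, ∃ a b, i < m → j < n → HasJet l z (fun τ => q τ i j) a b := by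
    intro i j
    by_cases hij : i < m ∧ j < n
    swap
    · exact ⟨0, 0, fun h1 h2 => absurd ⟨h1, h2⟩ hij⟩
    obtain ⟨hi, hj⟩ := hij
    suffices ∃ a b, HasJet l z (fun τ => q τ i j) a b by
      obtain ⟨a, b, hab⟩ := this
      exact ⟨a, b, fun _ _ => hab⟩
    -- Expansions exist along one path: through the bottom row, then up the column. Compatibility on
    -- all common edges follows afterwards from uniqueness of jets.
    induction j with
    | zero =>
      induction i with
      | zero =>
        exact ⟨_, _, HasJet.of_stretch (hρ 0 hi 0 hj).ne' (hq 0 hi 0 hj) hz hz0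
          ((hasJet_self z).congr' (hB 0 hi 0 hj).symm)⟩
      | succ i ih =>
        have hi' : i < m := by omega
        obtain ⟨a, b, hab⟩ := ih hi'
        exact ⟨_, _, HasJet.of_stretch (neg_ne_zero.2 (hσ _ hi 0 hj).ne') (hq _ hi 0 hj) hz hz0
          (((hab.stretch (hq i hi' 0 hj) hz hz0 _).congr' (hR i hi' 0 hj)).congr'
            (hLf _ hi 0 hj).symm)⟩
    | succ j ih =>
      have hj' : j < n := by omega
      obtain ⟨a, b, hab⟩ := ih hj'
      exact ⟨_, _, HasJet.of_stretch (hρ i hi _ hj).ne' (hq i hi _ hj) hz hz0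
        (((hab.stretch (hq i hi j hj') hz hz0 _).congr' (hT i hi j hj')).congr'
          (hB i hi _ hj).symm)⟩
  choose a b hab using key
  refine ⟨a, b, hρ, hσ, ?_, ?_, ?_, ?_⟩
  · exact (HasJet.unique (((hab 0 0 hm hn).stretch (hq 0 hm 0 hn) hz hz0 _).congr' (hB 0 hm 0 hn))
      (hasJet_self z) hz hz0).1
  · exact (HasJet.unique (((hab 0 0 hm hn).stretch (hq 0 hm 0 hn) hz hz0 _).congr' (hB 0 hm 0 hn))
      (hasJet_self z) hz hz0).2
  · intro i hi j hj
    have hj' : j < n := by omega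
    exact HasJet.unique
      (((hab i j hi hj').stretch (hq i hi j hj') hz hz0 _).congr' (hT i hi j hj'))
      (((hab i _ hi hj).stretch (hq i hi _ hj) hz hz0 _).congr' (hB i hi _ hj)) hz hz0
  · intro i hi j hj
    have hi' : i < m := by omega
    exact HasJet.unique
      (((hab i j hi' hj).stretch (hq i hi' j hj) hz hz0 _).congr' (hR i hi' j hj))
      (((hab _ j hi hj).stretch (hq _ hi j hj) hz hz0 _).congr' (hLf _ hi j hj)) hz hz0

/-! ### Parameters and edge ratios of nets -/

open scoped Classical in
/-- The point of the family with indices `i, j`, or `0` if there is no such point. -/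
noncomputable def pt {d : ℕ} {S : Set (ℕ × ℕ)} (P : S → E d) (i j : ℕ) : E d :=
  if h : (i, j) ∈ S then P ⟨(i, j), h⟩ else 0

/-- The first parameter of the face `(i, j)`. -/
noncomputable def rho {d : ℕ} {S : Set (ℕ × ℕ)} (P : S → E d) (i j : ℕ) : ℝ :=
  rhoOf (pt P i j) (pt P (i + 1) j) (pt P (i + 1) (j + 1)) (pt P i (j + 1))

/-- The second parameter of the face `(i, j)`. -/
noncomputable def sigma {d : ℕ} {S : Set (ℕ × ℕ)} (P : S → E d) (i j : ℕ) : ℝ :=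
  rhoOf (pt P i j) (pt P i (j + 1)) (pt P (i + 1) (j + 1)) (pt P (i + 1) j)

/-- The ratio of the edges from `(i, j)` to `(i + 1, j)` in two parallel nets. -/
noncomputable def hScale {d : ℕ} {S : Set (ℕ × ℕ)} (P P' : S → E d) (i j : ℕ) : ℝ :=
  inner ℝ (pt P' (i + 1) j - pt P' i j) (pt P (i + 1) j - pt P i j) /
    inner ℝ (pt P (i + 1) j - pt P i j) (pt P (i + 1) j - pt P i j)

/-- The ratio of the edges from `(i, j)` to `(i, j + 1)` in two parallel nets. -/
noncomputable def vScale {d : ℕ} {S : Set (ℕ × ℕ)} (P P' : S → E d) (i j : ℕ) : ℝ :=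
  inner ℝ (pt P' i (j + 1) - pt P' i j) (pt P i (j + 1) - pt P i j) /
    inner ℝ (pt P i (j + 1) - pt P i j) (pt P i (j + 1) - pt P i j)

section Points

variable {d m n : ℕ} {S : Set (ℕ × ℕ)} {i j : ℕ}

theorem pt_of_mem (P : S → E d) (h : (i, j) ∈ S) : pt P i j = P ⟨(i, j), h⟩ := dif_pos h

theorem v00_eq (P : S → E d) (h : IsCell S i j) : v00 P h = pt P i j := (pt_of_mem P h.1).symm

theorem v10_eq (P : S → E d) (h : IsCell S i j) : v10 P h = pt P (i + 1) j :=
  (pt_of_mem P h.2.1).symm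

theorem v11_eq (P : S → E d) (h : IsCell S i j) : v11 P h = pt P (i + 1) (j + 1) :=
  (pt_of_mem P h.2.2.1).symm

theorem v01_eq (P : S → E d) (h : IsCell S i j) : v01 P h = pt P i (j + 1) :=
  (pt_of_mem P h.2.2.2).symm

theorem mem_gridIndex : (i, j) ∈ gridIndex m n ↔ i ≤ m ∧ j ≤ n := Iff.rfl

theorem mem_lIndex : (i, j) ∈ lIndex m n ↔ i ≤ m ∧ j ≤ n ∧ (i ≤ 1 ∨ j ≤ 1) := by
  simp [lIndex]

theorem isCell_gridIndex : IsCell (gridIndex m n) i j ↔ i < m ∧ j < n := by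
  simp only [IsCell, mem_gridIndex]
  omega

theorem isCell_lIndex : IsCell (lIndex m n) i j ↔ i < m ∧ j < n ∧ (i = 0 ∨ j = 0) := by
  simp only [IsCell, mem_lIndex]
  omega

theorem pt_ext {P P' : S → E d} (h : ∀ i j, (i, j) ∈ S → pt P i j = pt P' i j) : P = P' := by
  funext ⟨⟨i, j⟩, hij⟩
  have := h i j hij
  rwa [pt_of_mem P hij, pt_of_mem P' hij] at this

theorem pt_lPart (P : gridIndex m n → E d) (h : (i, j) ∈ lIndex m n) :
    pt (lPart P) i j = pt P i j := by
  rw [pt_of_mem _ h, pt_of_mem _ (lIndex_subset_gridIndex m n h)]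
  rfl

theorem isNet_iff {P : S → E d} : IsNet P ↔ ∀ i j, IsCell S i j →
    ConvexQuad (pt P i j) (pt P (i + 1) j) (pt P (i + 1) (j + 1)) (pt P i (j + 1)) := by
  unfold IsNet
  refine forall_congr' fun i => forall_congr' fun j => forall_congr' fun h => ?_
  rw [v00_eq, v10_eq, v11_eq, v01_eq]

theorem FaceParam.sigma_eq {A B C D : E d} {ρ σ : ℝ} (h : FaceParam A B C D ρ σ) :
    rhoOf A D C B = σ := h.swap.rhoOf_eq

theorem IsNet.faceParam {P : S → E d} (hP : IsNet P) (h : IsCell S i j) :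
    FaceParam (pt P i j) (pt P (i + 1) j) (pt P (i + 1) (j + 1)) (pt P i (j + 1))
      (rho P i j) (sigma P i j) := by
  obtain ⟨ρ, σ, hp⟩ := convexQuad_iff.1 (isNet_iff.1 hP i j h)
  have h1 : rho P i j = ρ := hp.rhoOf_eq
  have h2 : sigma P i j = σ := hp.sigma_eq
  rwa [h1, h2]

theorem rho_lPart {P : gridIndex m n → E d} (h : IsCell (lIndex m n) i j) :
    rho (lPart P) i j = rho P i j := by
  unfold rho
  rw [pt_lPart P h.1, pt_lPart P h.2.1, pt_lPart P h.2.2.1, pt_lPart P h.2.2.2]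

theorem sigma_lPart {P : gridIndex m n → E d} (h : IsCell (lIndex m n) i j) :
    sigma (lPart P) i j = sigma P i j := by
  unfold sigma
  rw [pt_lPart P h.1, pt_lPart P h.2.1, pt_lPart P h.2.2.1, pt_lPart P h.2.2.2]

theorem FaceParam.edges_ne {A B C D : E d} {ρ σ : ℝ} (h : FaceParam A B C D ρ σ) :
    B - A ≠ 0 ∧ D - A ≠ 0 ∧ C - B ≠ 0 ∧ C - D ≠ 0 :=
  ⟨(ne_zero_of_gramDet_pos h.gram_pos).1, (ne_zero_of_gramDet_pos h.gram_pos).2,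
    (ne_zero_of_gramDet_pos h.swap.reflect.gram_pos).1,
    (ne_zero_of_gramDet_pos h.reflect.gram_pos).1⟩

theorem sub_eq_smul_of_parallel {A B A' B' : E d} (h0 : B - A ≠ 0)
    (h : (affineSpan ℝ {A, B}).Parallel (affineSpan ℝ {A', B'})) :
    B' - A' = (inner ℝ (B' - A') (B - A) / inner ℝ (B - A) (B - A) : ℝ) • (B - A) := by
  rw [AffineSubspace.affineSpan_pair_parallel_iff_vectorSpan_eq] at h
  have hmem : B' -ᵥ A' ∈ vectorSpan ℝ {A, B} := h ▸ vsub_rev_mem_vectorSpan_pair ℝ A' B'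
  rw [vectorSpan_pair_rev, Submodule.mem_span_singleton] at hmem
  obtain ⟨r, hr⟩ := hmem
  simp only [vsub_eq_sub] at hr
  have : (inner ℝ (B - A) (B - A) : ℝ) ≠ 0 := inner_self_ne_zero.2 h0
  rw [← hr, real_inner_smul_left, mul_div_assoc, div_self this, mul_one]

theorem parallel_of_sub_eq_smul {A B A' B' : E d} {x : ℝ} (hx : x ≠ 0)
    (h : B' - A' = x • (B - A)) :
    (affineSpan ℝ {A, B}).Parallel (affineSpan ℝ {A', B'}) := by
  rw [AffineSubspace.affineSpan_pair_parallel_iff_vectorSpan_eq, vectorSpan_pair_rev,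
    vectorSpan_pair_rev, vsub_eq_sub, vsub_eq_sub, h,
    Submodule.span_singleton_smul_eq (IsUnit.mk0 x hx)]

theorem ParallelNets.hScale_eq {P P' : S → E d} (h : ParallelNets P P') (h1 : (i, j) ∈ S)
    (h2 : (i + 1, j) ∈ S) (h0 : pt P (i + 1) j - pt P i j ≠ 0) :
    pt P' (i + 1) j - pt P' i j = hScale P P' i j • (pt P (i + 1) j - pt P i j) := by
  apply sub_eq_smul_of_parallel h0
  rw [pt_of_mem P h1, pt_of_mem P h2, pt_of_mem P' h1, pt_of_mem P' h2]
  exact h.1 i j h1 h2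

theorem ParallelNets.vScale_eq {P P' : S → E d} (h : ParallelNets P P') (h1 : (i, j) ∈ S)
    (h2 : (i, j + 1) ∈ S) (h0 : pt P i (j + 1) - pt P i j ≠ 0) :
    pt P' i (j + 1) - pt P' i j = vScale P P' i j • (pt P i (j + 1) - pt P i j) := by
  apply sub_eq_smul_of_parallel h0
  rw [pt_of_mem P h1, pt_of_mem P h2, pt_of_mem P' h1, pt_of_mem P' h2]
  exact h.2 i j h1 h2

theorem continuousAt_pt {X : Type*} [TopologicalSpace X] {F : X → S → E d} {x : X}
    (hF : ContinuousAt F x) (i j : ℕ) : ContinuousAt (fun y => pt (F y) i j) x := by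
  by_cases h : (i, j) ∈ S
  · simp only [pt_of_mem _ h]
    exact (continuousAt_pi.1 hF) _
  · simp only [pt, h, dite_false]
    exact continuousAt_const

theorem continuousAt_hScale {X : Type*} [TopologicalSpace X] {F : X → S → E d} {x : X}
    (hF : ContinuousAt F x) (P : S → E d) (i j : ℕ) :
    ContinuousAt (fun y => hScale P (F y) i j) x :=
  (((continuousAt_pt hF _ _).sub (continuousAt_pt hF _ _)).inner (𝕜 := ℝ)
    continuousAt_const).div_const _

theorem continuousAt_vScale {X : Type*} [TopologicalSpace X] {F : X → S → E d} {x : X}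
    (hF : ContinuousAt F x) (P : S → E d) (i j : ℕ) :
    ContinuousAt (fun y => vScale P (F y) i j) x :=
  (((continuousAt_pt hF _ _).sub (continuousAt_pt hF _ _)).inner (𝕜 := ℝ)
    continuousAt_const).div_const _

theorem hScale_self {P : S → E d} (h0 : pt P (i + 1) j - pt P i j ≠ 0) : hScale P P i j = 1 :=
  div_self (inner_self_ne_zero.2 h0)

theorem vScale_self {P : S → E d} (h0 : pt P i (j + 1) - pt P i j ≠ 0) : vScale P P i j = 1 :=
  div_self (inner_self_ne_zero.2 h0)

/-- The deformation parameter of the face `(i, j)` in a parallel net. -/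
noncomputable def qParam (P P' : S → E d) (i j : ℕ) : ℝ :=
  (hScale P P' i j - vScale P P' i j) / (rho P i j + sigma P i j)

/-- At `y = x` all stretching factors and `p` equal `1`, so by continuity they stay positive nearby.
This is what `FaceParam.stretch_of_parallel` requires. -/
theorem eventually_cellRel {X : Type*} [TopologicalSpace X] {F : X → S → E d} {x : X}
    (hF : ContinuousAt F x) (hnet : IsNet (F x)) (hpar : ∀ y, ParallelNets (F x) (F y))
    (harea : ∀ y, EqualAreas (F x) (F y)) (hc : IsCell S i j) :
    ∀ᶠ y in 𝓝 x, CellRel (rho (F x)) (sigma (F x)) (hScale (F x) (F y)) (vScale (F x) (F y))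
      (qParam (F x) (F y)) i j := by
  have hp := hnet.faceParam hc
  obtain ⟨n1, n2, n3, n4⟩ := hp.edges_ne
  have ch := fun i j => continuousAt_hScale hF (F x) i j
  have cv := fun i j => continuousAt_vScale hF (F x) i j
  have e1 := (ch i j).eventually_const_lt (show (0 : ℝ) < _ by simp only [hScale_self n1]; norm_num)
  have e2 := (ch i (j + 1)).eventually_const_lt (show (0 : ℝ) < _ by simp only [hScale_self n4]; norm_num)
  have e3 := (cv i j).eventually_const_lt (show (0 : ℝ) < _ by simp only [vScale_self n2]; norm_num)
  have e4 := (cv (i + 1) j).eventually_const_lt (show (0 : ℝ) < _ by simp only [vScale_self n3]; norm_num)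
  have c5 : ContinuousAt (fun y => hScale (F x) (F y) i j -
      rho (F x) i j * qParam (F x) (F y) i j) x :=
    (ch i j).sub (continuousAt_const.mul (((ch i j).sub (cv i j)).div_const _))
  have e5 := c5.eventually_const_lt (show (0 : ℝ) < _ by
    simp only [qParam, hScale_self n1, vScale_self n2]; norm_num)
  filter_upwards [e1, e2, e3, e4, e5] with y h1 h2 h3 h4 h5
  have ha := harea y i j hc
  simp only [v00_eq, v10_eq, v11_eq, v01_eq] at ha
  obtain ⟨r1, r2, r3, r4⟩ := hp.stretch_of_parallel ((hpar y).hScale_eq hc.1 hc.2.1 n1)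
    ((hpar y).vScale_eq hc.1 hc.2.2.2 n2) ((hpar y).vScale_eq hc.2.1 hc.2.2.1 n3)
    ((hpar y).hScale_eq hc.2.2.2 hc.2.2.1 n4) h1 h3 h4 h2 h5 ha.symm
  exact ⟨r1, r2, r3, r4⟩

end Points

/-! ### Uniqueness: a deformable net is determined by its `L`-shaped part -/

/-- The equation `stretch c q = 1` may have a second root, but there `|c| = |q| / (√(1 + q²) + 1) ≤
|q|`. -/
theorem eq_zero_of_stretch_eq_one {c q : ℝ} (hq : |q| < |c|) (h : stretch c q = 1) : q = 0 := by
  have h1 := stretch_sub_one c q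
  rw [h, sub_self] at h1
  have hp : 1 ≤ √(1 + q ^ 2) + 1 := by linarith [Real.sqrt_nonneg (1 + q ^ 2)]
  have h2 : q * (c + q / (√(1 + q ^ 2) + 1)) = 0 := by rw [h1]; ring
  rcases mul_eq_zero.1 h2 with h3 | h3
  · exact h3
  · exfalso
    have h4 : |c| = |q| / (√(1 + q ^ 2) + 1) := by
      rw [eq_neg_of_add_eq_zero_left h3, abs_neg, abs_div,
        abs_of_pos (show 0 < √(1 + q ^ 2) + 1 by linarith)]
    have h5 : |q| / (√(1 + q ^ 2) + 1) ≤ |q| := div_le_self (abs_nonneg q) hp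
    linarith

theorem eventually_forall_lt_lt {T : Type*} {l : Filter T} {m n : ℕ} {p : T → ℕ → ℕ → Prop}
    (hp : ∀ i < m, ∀ j < n, ∀ᶠ τ in l, p τ i j) : ∀ᶠ τ in l, ∀ i < m, ∀ j < n, p τ i j := by
  have := (eventually_all_finset (Finset.range m)).2 fun i hi =>
    (eventually_all_finset (Finset.range n)).2 fun j hj =>
      hp i (Finset.mem_range.1 hi) j (Finset.mem_range.1 hj)
  simpa only [Finset.mem_range] using this

/-- If the first edge keeps its length, then so do all edges. -/
theorem CellRel.eq_zero {m n : ℕ} {ρ σ h v q : ℕ → ℕ → ℝ}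
    (hrel : ∀ i < m, ∀ j < n, CellRel ρ σ h v q i j)
    (hρ : ∀ i < m, ∀ j < n, |q i j| < |ρ i j|) (hσ : ∀ i < m, ∀ j < n, |q i j| < |σ i j|)
    (h1 : h 0 0 = 1) : ∀ i < m, ∀ j < n, q i j = 0 := by
  intro i hi j hj
  induction j with
  | zero =>
    induction i with
    | zero => exact eq_zero_of_stretch_eq_one (hρ 0 hi 0 hj) ((hrel 0 hi 0 hj).bottom ▸ h1)
    | succ i ih =>
      have hi' : i < m := by omega
      apply eq_zero_of_stretch_eq_one (c := -σ (i + 1) 0) (by rw [abs_neg]; exact hσ _ hi _ hj)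
      rw [← (hrel _ hi _ hj).left, (hrel i hi' 0 hj).right, ih hi', stretch_zero]
  | succ j ih =>
    have hj' : j < n := by omega
    apply eq_zero_of_stretch_eq_one (hρ i hi (j + 1) hj)
    rw [← (hrel _ hi _ hj).bottom, (hrel i hi j hj').top, ih hj', stretch_zero]

section Grid

variable {d m n : ℕ}

theorem congruentNets_of_edges_eq {P P' : gridIndex m n → E d}
    (hh : ∀ i < m, ∀ j ≤ n, pt P' (i + 1) j - pt P' i j = pt P (i + 1) j - pt P i j)
    (hv : ∀ i ≤ m, ∀ j < n, pt P' i (j + 1) - pt P' i j = pt P i (j + 1) - pt P i j) :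
    CongruentNets P P' := by
  have key : ∀ i ≤ m, ∀ j ≤ n, pt P' i j - pt P i j = pt P' 0 0 - pt P 0 0 := by
    intro i hi j hj
    induction j with
    | zero =>
      induction i with
      | zero => rfl
      | succ i ih =>
        rw [← ih (by omega), sub_eq_sub_iff_sub_eq_sub]
        exact hh i (by omega) 0 hj
    | succ j ih =>
      rw [← ih (by omega), sub_eq_sub_iff_sub_eq_sub]
      exact hv i hi j (by omega)
  refine ⟨IsometryEquiv.addRight (pt P' 0 0 - pt P 0 0), ?_⟩
  rintro ⟨⟨i, j⟩, hij⟩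
  rw [← pt_of_mem P hij, ← pt_of_mem P' hij]
  simp [← key i hij.1 j hij.2]

/-- If the first edge kept its length at a small nonzero time, all parameters `q` would vanish and
the nets would differ by a translation. So non-congruence supplies the condition that the first
stretching differs from `1`. -/
theorem IsDeformable.exists_isJetField (hm : 1 ≤ m) (hn : 1 ≤ n) {P : gridIndex m n → E d}
    (hP : IsDeformable P) : ∃ a b, IsJetField m n (rho P) (sigma P) a b := by
  obtain ⟨F, hF, rfl, hnet, hpar, harea, hcong⟩ := hP
  have hFP := hnet 0
  have hc : ∀ i < m, ∀ j < n, IsCell (gridIndex m n) i j := fun i hi j hj =>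
    isCell_gridIndex.2 ⟨hi, hj⟩
  have hfp := fun i hi j hj => hFP.faceParam (hc i hi j hj)
  have hq : ∀ i < m, ∀ j < n, Tendsto (fun τ => qParam (F 0) (F τ) i j) (𝓝 0) (𝓝 0) := by
    intro i hi j hj
    obtain ⟨n1, n2, n3, n4⟩ := (hfp i hi j hj).edges_ne
    have := (((continuousAt_hScale hF.continuousAt (F 0) i j).sub
      (continuousAt_vScale hF.continuousAt (F 0) i j)).div_const
        (rho (F 0) i j + sigma (F 0) i j)).tendsto (x := (0 : unitInterval))
    simpa [qParam, hScale_self n1, vScale_self n2] using this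
  have hrel := eventually_forall_lt_lt fun i hi j hj => eventually_cellRel hF.continuousAt hFP
    (fun y => hpar 0 y) (fun y => harea 0 y) (hc i hi j hj)
  have hsmall : ∀ c : ℕ → ℕ → ℝ, (∀ i < m, ∀ j < n, 0 < c i j) →
      ∀ᶠ τ in 𝓝 0, ∀ i < m, ∀ j < n, |qParam (F 0) (F τ) i j| < |c i j| := by
    intro c hc'
    refine eventually_forall_lt_lt fun i hi j hj => ?_
    have := (hq i hi j hj).abs
    rw [abs_zero] at this
    exact this.eventually_lt_const (abs_pos.2 (hc' i hi j hj).ne')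
  have hs1 := hsmall _ fun i hi j hj => (hfp i hi j hj).rho_pos
  have hs2 := hsmall _ fun i hi j hj => (hfp i hi j hj).sigma_pos
  refine LNet.exists_isJetField (l := 𝓝[≠] (0 : unitInterval)) hm hn
    (fun i hi j hj => (hfp i hi j hj).rho_pos) (fun i hi j hj => (hfp i hi j hj).sigma_pos)
    (h := fun τ => hScale (F 0) (F τ)) (v := fun τ => vScale (F 0) (F τ))
    (q := fun τ => qParam (F 0) (F τ))
    (fun i hi j hj => (hq i hi j hj).mono_left nhdsWithin_le_nhds)
    (hrel.filter_mono nhdsWithin_le_nhds) ?_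
  filter_upwards [self_mem_nhdsWithin, nhdsWithin_le_nhds hrel, nhdsWithin_le_nhds hs1,
    nhdsWithin_le_nhds hs2] with τ hτ hr h1 h2 h00
  have hz := CellRel.eq_zero hr h1 h2 h00
  refine hcong 0 τ (Ne.symm hτ) (congruentNets_of_edges_eq ?_ ?_)
  · intro i hi j hj
    -- Horizontal edges with `j = n` bound no face from below; they are top sides of the last faces.
    -- The case `i = m` below is similar.
    rcases Nat.lt_or_ge j n with hjn | hjn
    · rw [(hpar 0 τ).hScale_eq (hc i hi j hjn).1 (hc i hi j hjn).2.1 (hfp i hi j hjn).edges_ne.1,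
        (hr i hi j hjn).bottom, hz i hi j hjn, stretch_zero, one_smul]
    · obtain ⟨k, rfl⟩ : ∃ k, j = k + 1 := ⟨j - 1, by omega⟩
      have hk : k < n := by omega
      rw [(hpar 0 τ).hScale_eq (hc i hi k hk).2.2.2 (hc i hi k hk).2.2.1
          (hfp i hi k hk).edges_ne.2.2.2,
        (hr i hi k hk).top, hz i hi k hk, stretch_zero, one_smul]
  · intro i hi j hj
    rcases Nat.lt_or_ge i m with him | him
    · rw [(hpar 0 τ).vScale_eq (hc i him j hj).1 (hc i him j hj).2.2.2
          (hfp i him j hj).edges_ne.2.1,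
        (hr i him j hj).left, hz i him j hj, stretch_zero, one_smul]
    · obtain ⟨k, rfl⟩ : ∃ k, i = k + 1 := ⟨i - 1, by omega⟩
      have hk : k < m := by omega
      rw [(hpar 0 τ).vScale_eq (hc k hk j hj).2.1 (hc k hk j hj).2.2.1
          (hfp k hk j hj).edges_ne.2.2.1,
        (hr k hk j hj).right, hz k hk j hj, stretch_zero, one_smul]

/-- A deformable net is determined by its `L`-shaped part. -/
theorem IsDeformable.eq_of_lPart_eq (hm : 1 ≤ m) (hn : 1 ≤ n) {P P' : gridIndex m n → E d}
    (hP : IsNet P) (hP' : IsNet P') (hd : IsDeformable P) (hd' : IsDeformable P')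
    (hL : lPart P = lPart P') : P = P' := by
  obtain ⟨a, b, hab⟩ := hd.exists_isJetField hm hn
  obtain ⟨a', b', hab'⟩ := hd'.exists_isJetField hm hn
  have key := hab.eq hab' fun i hi j hj hij => by
    have hc := isCell_lIndex.2 ⟨hi, hj, hij⟩
    rw [← rho_lPart hc, ← sigma_lPart hc, hL, rho_lPart hc, sigma_lPart hc]
    exact ⟨rfl, rfl⟩
  refine pt_ext fun i j hij => ?_
  obtain ⟨hi, hj⟩ := mem_gridIndex.1 hij
  have hLpt : ∀ i j, i ≤ m → j ≤ n → (i ≤ 1 ∨ j ≤ 1) → pt P i j = pt P' i j := by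
    intro i j hi hj hij
    have hmem := mem_lIndex.2 ⟨hi, hj, hij⟩
    rw [← pt_lPart P hmem, ← pt_lPart P' hmem, hL]
  clear hij
  induction i generalizing j with
  | zero => exact hLpt 0 j hi hj (Or.inl (by omega))
  | succ i ihi =>
    induction j with
    | zero => exact hLpt (i + 1) 0 hi hj (Or.inr (by omega))
    | succ j ihj =>
      -- The fourth vertex of a face is determined by the other three and by `ρ, σ`.
      have hc := isCell_gridIndex.2 (⟨by omega, by omega⟩ : i < m ∧ j < n)
      have h1 := (hP.faceParam hc).sub_eq
      have h2 := (hP'.faceParam hc).sub_eq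
      obtain ⟨e1, e2⟩ := key i (by omega) j (by omega)
      rw [← ihi j (by omega) (by omega), ← ihi (j + 1) (by omega) hj, ← ihj (by omega),
        ← e1, ← e2, ← h1] at h2
      exact (sub_left_inj.1 h2).symm

end Grid

/-! ### Deformations from consistent stretchings of edges -/

/-- The family of points with the edges of `P` stretched by the factors `h` and `v`. -/
noncomputable def stretchedPt {d : ℕ} {S : Set (ℕ × ℕ)} (P : S → E d) (h v : ℕ → ℕ → ℝ)
    (i j : ℕ) : E d :=
  pt P 0 0 + ∑ k ∈ Finset.range i, h k 0 • (pt P (k + 1) 0 - pt P k 0) +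
    ∑ l ∈ Finset.range j, v i l • (pt P i (l + 1) - pt P i l)

section Stretched

variable {d m n : ℕ} {P : gridIndex m n → E d} {h v q : ℕ → ℕ → ℝ}

theorem stretchedPt_vert (P : gridIndex m n → E d) (h v : ℕ → ℕ → ℝ) (i j : ℕ) :
    stretchedPt P h v i (j + 1) - stretchedPt P h v i j =
      v i j • (pt P i (j + 1) - pt P i j) := by
  rw [stretchedPt, stretchedPt, Finset.sum_range_succ _ j]
  abel

/-- The points are reached along the bottom row and then up a column, so only these edges are
stretched by construction. Closing of the faces carries the horizontal factors from each row to the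
next. -/
theorem stretchedPt_horiz (hP : IsNet P)
    (hrel : ∀ i < m, ∀ j < n, CellRel (rho P) (sigma P) h v q i j) {i j : ℕ} (hi : i < m)
    (hj : j ≤ n) :
    stretchedPt P h v (i + 1) j - stretchedPt P h v i j =
      h i j • (pt P (i + 1) j - pt P i j) := by
  induction j with
  | zero =>
    simp only [stretchedPt, Finset.sum_range_succ _ i, Finset.range_zero, Finset.sum_empty]
    abel
  | succ j ih =>
    have hc := hrel i hi j hj
    have hf := hP.faceParam (isCell_gridIndex.2 ⟨hi, hj⟩)
    rw [hc.top]
    exact hf.closure (by rw [ih (by omega), hc.bottom]) (by rw [stretchedPt_vert, hc.left])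
      (by rw [stretchedPt_vert, hc.right])

theorem stretchedPt_one {i j : ℕ} (hh : ∀ i j, h i j = 1) (hv : ∀ i j, v i j = 1) :
    stretchedPt P h v i j = pt P i j := by
  simp only [stretchedPt, hh, hv, one_smul]
  rw [Finset.sum_range_sub (fun k => pt P k 0), Finset.sum_range_sub (fun l => pt P i l)]
  abel

theorem convexQuad_stretchedPt (hP : IsNet P)
    (hrel : ∀ i < m, ∀ j < n, CellRel (rho P) (sigma P) h v q i j)
    (hh : ∀ i ≤ m, ∀ j ≤ n, 0 < h i j) (hv : ∀ i ≤ m, ∀ j ≤ n, 0 < v i j) {i j : ℕ}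
    (hi : i < m) (hj : j < n) :
    ConvexQuad (stretchedPt P h v i j) (stretchedPt P h v (i + 1) j)
      (stretchedPt P h v (i + 1) (j + 1)) (stretchedPt P h v i (j + 1)) ∧
    quadArea (stretchedPt P h v i j) (stretchedPt P h v (i + 1) j)
      (stretchedPt P h v (i + 1) (j + 1)) (stretchedPt P h v i (j + 1)) =
    quadArea (pt P i j) (pt P (i + 1) j) (pt P (i + 1) (j + 1)) (pt P i (j + 1)) := by
  have hf := hP.faceParam (isCell_gridIndex.2 ⟨hi, hj⟩)
  have hc := hrel i hi j hj
  have e1 := stretchedPt_horiz hP hrel hi hj.le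
  have e2 := stretchedPt_vert P h v i j
  have e3 := stretchedPt_vert P h v (i + 1) j
  have p1 := hh i hi.le j hj.le
  have p2 := hh i hi.le (j + 1) hj
  have p3 := hv i hi.le j hj.le
  have p4 := hv (i + 1) hi j hj.le
  rw [hc.bottom] at e1 p1
  rw [hc.top] at p2
  rw [hc.left] at e2 p3
  rw [hc.right] at e3 p4
  exact ⟨convexQuad_iff.2 ⟨_, _, hf.deform e1 e2 e3 p1 p2 p3 p4⟩,
    hf.quadArea_deform e1 e2 e3 p1 p2 p3 p4⟩

/-- A net is deformable once its edges can be stretched consistently. -/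
theorem isDeformable_of_stretch (hm : 1 ≤ m) (hn : 1 ≤ n) (hP : IsNet P)
    {h v q : ℝ → ℕ → ℕ → ℝ}
    (hh : ∀ i j, ∀ᶠ x in 𝓝 0, ContinuousAt (fun y => h y i j) x)
    (hv : ∀ i j, ∀ᶠ x in 𝓝 0, ContinuousAt (fun y => v y i j) x)
    (hh0 : ∀ i j, h 0 i j = 1) (hv0 : ∀ i j, v 0 i j = 1)
    (hrel : ∀ᶠ x in 𝓝 0, ∀ i < m, ∀ j < n, CellRel (rho P) (sigma P) (h x) (v x) (q x) i j)
    (hq : ∀ x, q x 0 0 = x) : IsDeformable P := by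
  have hgood : ∀ᶠ x in 𝓝 (0 : ℝ), ∀ i < m + 1, ∀ j < n + 1,
      ContinuousAt (fun y => h y i j) x ∧ ContinuousAt (fun y => v y i j) x ∧
        0 < h x i j ∧ 0 < v x i j := by
    refine eventually_forall_lt_lt fun i _ j _ => ?_
    have e1 := (hh i j).self_of_nhds.eventually_const_lt
      (show (0 : ℝ) < _ by simp only [hh0]; norm_num)
    have e2 := (hv i j).self_of_nhds.eventually_const_lt
      (show (0 : ℝ) < _ by simp only [hv0]; norm_num)
    filter_upwards [hh i j, hv i j, e1, e2] with x h1 h2 h3 h4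
    exact ⟨h1, h2, h3, h4⟩
  obtain ⟨ε, hε, hball⟩ := Metric.eventually_nhds_iff.1 (hgood.and hrel)
  -- Time is rescaled so that all of `[0, 1]` maps into the neighbourhood of `0` where the
  -- relations, continuity and positivity hold.
  set δ : ℝ := ε / 2 with hδ
  have hδ0 : 0 < δ := by positivity
  have hx : ∀ t : unitInterval, dist (δ * (t : ℝ)) 0 < ε := by
    intro t
    rw [Real.dist_eq, sub_zero, abs_of_nonneg (mul_nonneg hδ0.le t.2.1)]
    have := t.2.2
    nlinarith
  have hG := fun t => hball (hx t)
  set F : unitInterval → gridIndex m n → E d := fun t p =>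
    stretchedPt P (h (δ * t)) (v (δ * t)) p.1.1 p.1.2 with hFdef
  have hpt : ∀ t i j, (i, j) ∈ gridIndex m n →
      pt (F t) i j = stretchedPt P (h (δ * t)) (v (δ * t)) i j := fun t i j hij =>
    pt_of_mem _ hij
  have hpt' : ∀ t i j (hij : (i, j) ∈ gridIndex m n),
      F t ⟨(i, j), hij⟩ = stretchedPt P (h (δ * t)) (v (δ * t)) i j := fun _ _ _ _ => rfl
  have hrel' := fun t => (hG t).2
  have hpos : ∀ t : unitInterval, (∀ i ≤ m, ∀ j ≤ n, 0 < h (δ * t) i j) ∧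
      ∀ i ≤ m, ∀ j ≤ n, 0 < v (δ * t) i j := fun t =>
    ⟨fun i hi j hj => ((hG t).1 i (by omega) j (by omega)).2.2.1,
      fun i hi j hj => ((hG t).1 i (by omega) j (by omega)).2.2.2⟩
  have hface := fun t i j (hc : IsCell (gridIndex m n) i j) =>
    convexQuad_stretchedPt hP (hrel' t) (hpos t).1 (hpos t).2 (isCell_gridIndex.1 hc).1
      (isCell_gridIndex.1 hc).2
  refine ⟨F, ?_, ?_, ?_, ?_, ?_, ?_⟩
  · refine continuous_pi fun ⟨⟨i, j⟩, hij⟩ => continuous_iff_continuousAt.2 fun t => ?_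
    obtain ⟨hi, hj⟩ := mem_gridIndex.1 hij
    have hmul : ContinuousAt (fun s : unitInterval => δ * (s : ℝ)) t := by fun_prop
    simp only [hFdef, stretchedPt]
    refine (continuousAt_const.add ?_).add ?_
    · refine tendsto_finsetSum _ fun k hk => ?_
      have hk := Finset.mem_range.1 hk
      exact (ContinuousAt.comp (f := fun s : unitInterval => δ * (s : ℝ))
        ((hG t).1 k (by omega) 0 (by omega)).1 hmul).smul continuousAt_const
    · refine tendsto_finsetSum _ fun k hk => ?_
      have hk := Finset.mem_range.1 hk
      exact (ContinuousAt.comp (f := fun s : unitInterval => δ * (s : ℝ))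
        ((hG t).1 i (by omega) k (by omega)).2.1 hmul).smul continuousAt_const
  · refine pt_ext fun i j hij => ?_
    rw [hpt 0 i j hij]
    simp only [Set.Icc.coe_zero, mul_zero]
    exact stretchedPt_one hh0 hv0
  · intro t
    rw [isNet_iff]
    intro i j hc
    rw [hpt _ _ _ hc.1, hpt _ _ _ hc.2.1, hpt _ _ _ hc.2.2.1, hpt _ _ _ hc.2.2.2]
    exact (hface t i j hc).1
  · intro s t
    constructor
    · intro i j h1 h2
      simp only [hpt']
      obtain ⟨hi, hj⟩ := mem_gridIndex.1 h2
      have a1 := (hpos s).1 i (by omega) j hj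
      have a2 := (hpos t).1 i (by omega) j hj
      refine parallel_of_sub_eq_smul (x := h (δ * t) i j / h (δ * s) i j)
        (div_ne_zero a2.ne' a1.ne') ?_
      rw [stretchedPt_horiz hP (hrel' s) (by omega) hj, stretchedPt_horiz hP (hrel' t) (by omega) hj,
        smul_smul, div_mul_cancel₀ _ a1.ne']
    · intro i j h1 h2
      simp only [hpt']
      obtain ⟨hi, hj⟩ := mem_gridIndex.1 h1
      have a1 := (hpos s).2 i hi j hj
      have a2 := (hpos t).2 i hi j hj
      refine parallel_of_sub_eq_smul (x := v (δ * t) i j / v (δ * s) i j)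
        (div_ne_zero a2.ne' a1.ne') ?_
      rw [stretchedPt_vert, stretchedPt_vert, smul_smul, div_mul_cancel₀ _ a1.ne']
  · intro s t i j hc
    simp only [v00_eq, v10_eq, v11_eq, v01_eq]
    rw [hpt _ _ _ hc.1, hpt _ _ _ hc.2.1, hpt _ _ _ hc.2.2.1, hpt _ _ _ hc.2.2.2,
      hpt _ _ _ hc.1, hpt _ _ _ hc.2.1, hpt _ _ _ hc.2.2.1, hpt _ _ _ hc.2.2.2,
      (hface s i j hc).2, (hface t i j hc).2]
  -- The length of the first edge separates times: its factor `stretch (ρ 0 0) x` is strictly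
  -- increasing for `x ≥ 0`, and only such `x = δ t` occur.
  · rintro s t hst ⟨g, hg⟩
    apply hst
    have h0 : (0, 0) ∈ gridIndex m n := ⟨by simp, by simp⟩
    have h1 : (0 + 1, 0) ∈ gridIndex m n := ⟨by simpa using hm, by simp⟩
    have hd := g.dist_eq (F s ⟨_, h1⟩) (F s ⟨_, h0⟩)
    rw [hg, hg, hpt', hpt', hpt', hpt', dist_eq_norm, dist_eq_norm,
      stretchedPt_horiz hP (hrel' s) hm (Nat.zero_le n),
      stretchedPt_horiz hP (hrel' t) hm (Nat.zero_le n), norm_smul, norm_smul,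
      Real.norm_of_nonneg ((hpos s).1 0 (Nat.zero_le m) 0 (Nat.zero_le n)).le,
      Real.norm_of_nonneg ((hpos t).1 0 (Nat.zero_le m) 0 (Nat.zero_le n)).le] at hd
    have hf := hP.faceParam (isCell_gridIndex.2 ⟨hm, hn⟩)
    have hd := mul_right_cancel₀ (norm_ne_zero_iff.2 hf.edges_ne.1) hd
    rw [(hrel' s 0 hm 0 hn).bottom, (hrel' t 0 hm 0 hn).bottom, hq, hq] at hd
    have := (stretch_strictMonoOn hf.rho_pos).injOn
      (Set.mem_Ici.2 (mul_nonneg hδ0.le t.2.1)) (Set.mem_Ici.2 (mul_nonneg hδ0.le s.2.1)) hd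
    exact (Subtype.ext (mul_left_cancel₀ hδ0.ne' this)).symm

end Stretched

/-- The derivative of `stretch c` at `0` is `c ≠ 0`, so the inverse function theorem applies.
Continuity is recorded on a neighbourhood of `1` because the deformation must be continuous at all
times. -/
theorem exists_stretch_rightInverse {c : ℝ} (hc : c ≠ 0) :
    ∃ g : ℝ → ℝ, g 1 = 0 ∧ ∀ᶠ y in 𝓝 1, ContinuousAt g y ∧ stretch c (g y) = y := by
  have hd : HasStrictDerivAt (stretch c) c 0 := by
    have h1 : HasStrictDerivAt (fun q : ℝ => 1 + q ^ 2) 0 0 := by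
      simpa using ((hasStrictDerivAt_id (0 : ℝ)).pow 2).const_add 1
    have h2 := h1.sqrt (by norm_num)
    have h3 : HasStrictDerivAt (stretch c) (0 / (2 * √(1 + (0 : ℝ) ^ 2)) + c * 1) 0 :=
      h2.add ((hasStrictDerivAt_id (0 : ℝ)).const_mul c)
    simpa using h3
  have hf := hd.hasStrictFDerivAt_equiv hc
  set e := hf.toOpenPartialHomeomorph (stretch c) with he
  have hcoe : (e : ℝ → ℝ) = stretch c := hf.toOpenPartialHomeomorph_coe
  have h0 : (0 : ℝ) ∈ e.source := hf.mem_toOpenPartialHomeomorph_source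
  have h1 : (1 : ℝ) ∈ e.target := by
    have := e.map_source h0
    rwa [hcoe, stretch_zero] at this
  refine ⟨e.symm, ?_, ?_⟩
  · have := e.left_inv h0
    rwa [hcoe, stretch_zero] at this
  · filter_upwards [e.open_target.mem_nhds h1] with y hy
    exact ⟨e.continuousAt_symm hy, by rw [← hcoe]; exact e.right_inv hy⟩

/-- Deformation parameters of a strip of faces glued along parallel sides. -/
theorem exists_param_seq (α β : ℕ → ℝ) (hβ : ∀ i, β i ≠ 0) :
    ∃ q : ℕ → ℝ → ℝ, (∀ x, q 0 x = x) ∧ (∀ i, q i 0 = 0) ∧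
      (∀ i, ∀ᶠ x in 𝓝 0, ContinuousAt (q i) x) ∧
      ∀ i, ∀ᶠ x in 𝓝 0, stretch (α i) (q i x) = stretch (β (i + 1)) (q (i + 1) x) := by
  choose g hg0 hg using fun i => exists_stretch_rightInverse (hβ i)
  -- Each parameter is solved from the stretching that the preceding strip imposes on the common
  -- side.
  let q : ℕ → ℝ → ℝ := fun i => Nat.rec (fun x => x)
    (fun k qk x => g (k + 1) (stretch (α k) (qk x))) i
  have hq1 : ∀ i x, q (i + 1) x = g (i + 1) (stretch (α i) (q i x)) := fun i x => rfl
  have hq0 : ∀ i, q i 0 = 0 := by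
    intro i
    induction i with
    | zero => rfl
    | succ i ih => rw [hq1, ih, stretch_zero, hg0]
  have hc0 : ∀ i, (∀ᶠ x in 𝓝 0, ContinuousAt (q i) x) →
      ∀ᶠ x in 𝓝 0, ContinuousAt (g (i + 1)) (stretch (α i) (q i x)) ∧
        stretch (β (i + 1)) (g (i + 1) (stretch (α i) (q i x))) = stretch (α i) (q i x) := by
    intro i hi
    have : Tendsto (fun x => stretch (α i) (q i x)) (𝓝 0) (𝓝 1) := by
      have := ((continuous_stretch (α i)).continuousAt.comp hi.self_of_nhds).tendsto
      simpa [Function.comp_def, hq0, stretch_zero] using this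
    exact this.eventually (hg (i + 1))
  have hc : ∀ i, ∀ᶠ x in 𝓝 0, ContinuousAt (q i) x := by
    intro i
    induction i with
    | zero => exact Eventually.of_forall fun x => continuousAt_id
    | succ i ih =>
      filter_upwards [ih, hc0 i ih] with x h1 h2
      exact ContinuousAt.comp (f := fun x => stretch (α i) (q i x)) h2.1
        ((continuous_stretch (α i)).continuousAt.comp h1)
  exact ⟨q, fun x => rfl, hq0, hc, fun i => (hc0 i (hc i)).mono fun x hx => hx.2.symm⟩

/-- The sequence `c, c⁻¹, c, c⁻¹, …`. -/
noncomputable def alt (c : ℝ) (j : ℕ) : ℝ := if Even j then c else c⁻¹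

theorem alt_zero (c : ℝ) : alt c 0 = c := by simp [alt]

theorem alt_succ (c : ℝ) (j : ℕ) : alt c (j + 1) = (alt c j)⁻¹ := by
  by_cases h : Even j <;> simp [alt, h, Nat.even_add_one]

theorem alt_pos {c : ℝ} (hc : 0 < c) (j : ℕ) : 0 < alt c j := by
  unfold alt
  split_ifs <;> positivity

theorem alt_one (j : ℕ) : alt 1 j = 1 := by simp [alt]

theorem alt_mul (a b : ℝ) (j : ℕ) : alt (a * b) j = alt a j * alt b j := by
  unfold alt
  split_ifs
  · rfl
  · exact mul_inv a b

theorem continuousAt_alt {X : Type*} [TopologicalSpace X] {f : X → ℝ} {x : X}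
    (hf : ContinuousAt f x) (h0 : f x ≠ 0) (j : ℕ) : ContinuousAt (fun y => alt (f y) j) x := by
  unfold alt
  split_ifs
  · exact hf
  · exact hf.inv₀ h0

section Cases

variable {d m n : ℕ} {P : gridIndex m n → E d}

/-- For fixed `i` the faces share `σ` and have alternately inverse `ρ`, so one `q` serves all of
them. Matching neighbouring strips is then one equation for each `i`, independent of `j`. -/
theorem isDeformable_of_affineSymmetric_vert (hm : 1 ≤ m) (hn : 1 ≤ n) (hP : IsNet P)
    {r s : ℕ → ℝ} (hs : ∀ i, s i ≠ 0)
    (hrs : ∀ i < m, ∀ j < n, rho P i j = alt (r i) j ∧ sigma P i j = s i) : IsDeformable P := by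
  obtain ⟨q, hq, hq0, hqc, hqs⟩ := exists_param_seq (fun i => -(s i)⁻¹) (fun i => -s i)
    fun i => neg_ne_zero.2 (hs i)
  refine isDeformable_of_stretch hm hn hP (h := fun x i j => stretch (alt (r i) j) (q i x))
    (v := fun x i _ => stretch (-s i) (q i x)) (q := fun x i _ => q i x) ?_ ?_ ?_ ?_ ?_ hq
  · exact fun i j => (hqc i).mono fun x hx => (continuous_stretch _).continuousAt.comp hx
  · exact fun i j => (hqc i).mono fun x hx => (continuous_stretch _).continuousAt.comp hx
  · simp [hq0, stretch_zero]
  · simp [hq0, stretch_zero]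
  · refine eventually_forall_lt_lt fun i hi j hj => (hqs i).mono fun x hx => ?_
    obtain ⟨h1, h2⟩ := hrs i hi j hj
    constructor <;> simp only [h1, h2, alt_succ, hx]

theorem isDeformable_of_affineSymmetric_horiz (hm : 1 ≤ m) (hn : 1 ≤ n) (hP : IsNet P)
    {r s : ℕ → ℝ} (hr : ∀ j, r j ≠ 0)
    (hrs : ∀ i < m, ∀ j < n, rho P i j = r j ∧ sigma P i j = alt (s j) i) : IsDeformable P := by
  obtain ⟨q, hq, hq0, hqc, hqs⟩ := exists_param_seq (fun j => (r j)⁻¹) r hr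
  refine isDeformable_of_stretch hm hn hP (h := fun x _ j => stretch (r j) (q j x))
    (v := fun x i j => stretch (-alt (s j) i) (q j x)) (q := fun x _ j => q j x) ?_ ?_ ?_ ?_ ?_ hq
  · exact fun i j => (hqc j).mono fun x hx => (continuous_stretch _).continuousAt.comp hx
  · exact fun i j => (hqc j).mono fun x hx => (continuous_stretch _).continuousAt.comp hx
  · simp [hq0, stretch_zero]
  · simp [hq0, stretch_zero]
  · refine eventually_forall_lt_lt fun i hi j hj => (hqs j).mono fun x hx => ?_
    obtain ⟨h1, h2⟩ := hrs i hi j hj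
    constructor <;> simp only [h1, h2, alt_succ, hx]

/-- Since `ρ` is inverted across each horizontal edge and `σ` across each vertical one, one and the
same `q` for all faces is consistent. -/
theorem isDeformable_of_equalRatios (hm : 1 ≤ m) (hn : 1 ≤ n) (hP : IsNet P) {r s : ℕ → ℝ}
    (hrs : ∀ i < m, ∀ j < n, rho P i j = alt (r i) j ∧ sigma P i j = alt (s j) i) :
    IsDeformable P := by
  refine isDeformable_of_stretch hm hn hP (h := fun x i j => stretch (alt (r i) j) x)
    (v := fun x i j => stretch (-alt (s j) i) x) (q := fun x _ _ => x) ?_ ?_ ?_ ?_ ?_ fun _ => rfl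
  · exact fun i j => Eventually.of_forall fun x => (continuous_stretch _).continuousAt
  · exact fun i j => Eventually.of_forall fun x => (continuous_stretch _).continuousAt
  · simp [stretch_zero]
  · simp [stretch_zero]
  · refine eventually_forall_lt_lt fun i hi j hj => Eventually.of_forall fun x => ?_
    obtain ⟨h1, h2⟩ := hrs i hi j hj
    constructor <;> simp only [h1, h2, alt_succ]

end Cases

/-! ### Completion of an `L`-shaped net -/

/-- First parameters of the faces of the completion. -/
noncomputable def extRho {d : ℕ} {S : Set (ℕ × ℕ)} (Q : S → E d) (i j : ℕ) : ℝ :=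
  rho Q 0 j * alt (rho Q i 0 / rho Q 0 0) j

/-- Second parameters of the faces of the completion. -/
noncomputable def extSigma {d : ℕ} {S : Set (ℕ × ℕ)} (Q : S → E d) (i j : ℕ) : ℝ :=
  sigma Q i 0 * alt (sigma Q 0 j / sigma Q 0 0) i

/-- The points of the completion. -/
noncomputable def extPt {d : ℕ} {S : Set (ℕ × ℕ)} (Q : S → E d) : ℕ → ℕ → E d
  | 0, j => pt Q 0 j
  | i + 1, 0 => pt Q (i + 1) 0
  | i + 1, j + 1 =>
    if i = 0 ∨ j = 0 then pt Q (i + 1) (j + 1) else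
      extPt Q i j +
        (((1 + extRho Q i j * extSigma Q i j) * extRho Q i j / (extRho Q i j + extSigma Q i j)) •
          (extPt Q (i + 1) j - extPt Q i j) +
        ((1 + extRho Q i j * extSigma Q i j) * extSigma Q i j / (extRho Q i j + extSigma Q i j)) •
          (extPt Q i (j + 1) - extPt Q i j))

/-- The `m × n` family of points completing an `L`-shaped one. -/
noncomputable def completion {d m n : ℕ} (Q : lIndex m n → E d) : gridIndex m n → E d :=
  fun p => extPt Q p.1.1 p.1.2

section Completion

variable {d m n : ℕ} {Q : lIndex m n → E d} {i j : ℕ}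

theorem extPt_of_le (Q : lIndex m n → E d) (h : i ≤ 1 ∨ j ≤ 1) : extPt Q i j = pt Q i j := by
  match i, j with
  | 0, j => rw [extPt]
  | i + 1, 0 => rw [extPt]
  | i + 1, j + 1 => rw [extPt, if_pos (by omega)]

theorem extPt_succ_succ (Q : lIndex m n → E d) (h : ¬(i = 0 ∨ j = 0)) :
    extPt Q (i + 1) (j + 1) = extPt Q i j +
        (((1 + extRho Q i j * extSigma Q i j) * extRho Q i j / (extRho Q i j + extSigma Q i j)) •
          (extPt Q (i + 1) j - extPt Q i j) +
        ((1 + extRho Q i j * extSigma Q i j) * extSigma Q i j / (extRho Q i j + extSigma Q i j)) •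
          (extPt Q i (j + 1) - extPt Q i j)) := by
  rw [extPt, if_neg h]

theorem pt_completion (Q : lIndex m n → E d) (h : (i, j) ∈ gridIndex m n) :
    pt (completion Q) i j = extPt Q i j := pt_of_mem _ h

theorem lPart_completion (Q : lIndex m n → E d) : lPart (completion Q) = Q := by
  refine pt_ext fun i j h => ?_
  rw [pt_lPart _ h, pt_completion Q (lIndex_subset_gridIndex m n h),
    extPt_of_le Q (mem_lIndex.1 h).2.2]

theorem isCell_row (hi : i < m) (hn : 1 ≤ n) : IsCell (lIndex m n) i 0 :=
  isCell_lIndex.2 ⟨hi, hn, Or.inr rfl⟩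

theorem isCell_col (hm : 1 ≤ m) (hj : j < n) : IsCell (lIndex m n) 0 j :=
  isCell_lIndex.2 ⟨hm, hj, Or.inl rfl⟩

theorem extRho_pos (hQ : IsNet Q) (hi : i < m) (hj : j < n) : 0 < extRho Q i j := by
  have h0 := (hQ.faceParam (isCell_row (show 0 < m by omega) (show 1 ≤ n by omega))).rho_pos
  have h1 := (hQ.faceParam (isCell_row hi (show 1 ≤ n by omega))).rho_pos
  have h2 := (hQ.faceParam (isCell_col (show 1 ≤ m by omega) hj)).rho_pos
  exact mul_pos h2 (alt_pos (div_pos h1 h0) j)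

theorem extSigma_pos (hQ : IsNet Q) (hi : i < m) (hj : j < n) : 0 < extSigma Q i j := by
  have h0 := (hQ.faceParam (isCell_row (show 0 < m by omega) (show 1 ≤ n by omega))).sigma_pos
  have h1 := (hQ.faceParam (isCell_row hi (show 1 ≤ n by omega))).sigma_pos
  have h2 := (hQ.faceParam (isCell_col (show 1 ≤ m by omega) hj)).sigma_pos
  exact mul_pos h1 (alt_pos (div_pos h2 h0) i)

theorem extParam_eq (hQ : IsNet Q) (h : IsCell (lIndex m n) i j) :
    extRho Q i j = rho Q i j ∧ extSigma Q i j = sigma Q i j := by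
  obtain ⟨hi, hj, hij⟩ := isCell_lIndex.1 h
  have h0 := hQ.faceParam (isCell_row (show 0 < m by omega) (show 1 ≤ n by omega))
  have h1 := h0.rho_pos.ne'
  have h2 := h0.sigma_pos.ne'
  unfold extRho extSigma
  rcases hij with rfl | rfl
  · rw [div_self h1, alt_one, alt_zero, mul_one]
    exact ⟨rfl, by field_simp⟩
  · rw [div_self h2, alt_one, alt_zero, mul_one]
    exact ⟨by field_simp, rfl⟩

theorem faceParam_completion (hQ : IsNet Q) (hi : i < m) (hj : j < n)
    (hg : 0 < gramDet (extPt Q (i + 1) j - extPt Q i j) (extPt Q i (j + 1) - extPt Q i j)) :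
    FaceParam (extPt Q i j) (extPt Q (i + 1) j) (extPt Q (i + 1) (j + 1)) (extPt Q i (j + 1))
      (extRho Q i j) (extSigma Q i j) := by
  have hρ := extRho_pos hQ hi hj
  have hσ := extSigma_pos hQ hi hj
  by_cases hij : i = 0 ∨ j = 0
  · have hc := isCell_lIndex.2 ⟨hi, hj, hij⟩
    obtain ⟨e1, e2⟩ := extParam_eq hQ hc
    rw [e1, e2, extPt_of_le Q (by omega), extPt_of_le Q (by omega), extPt_of_le Q (by omega),
      extPt_of_le Q (by omega)]
    exact hQ.faceParam hc
  · refine ⟨hρ, hσ, hg, ?_⟩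
    rw [extPt_succ_succ Q hij, add_sub_cancel_left, smul_add, smul_smul, smul_smul,
      mul_div_cancel₀ _ (add_pos hρ hσ).ne', mul_div_cancel₀ _ (add_pos hρ hσ).ne']

/-- The parallelograms at the corners of the faces of the completion do not degenerate. -/
def NondegenerateCompletion (Q : lIndex m n → E d) : Prop :=
  ∀ i < m, ∀ j < n,
    0 < gramDet (extPt Q (i + 1) j - extPt Q i j) (extPt Q i (j + 1) - extPt Q i j)

theorem isNet_completion (hQ : IsNet Q) (hg : NondegenerateCompletion Q) :
    IsNet (completion Q) := by
  refine isNet_iff.2 fun i j hc => ?_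
  obtain ⟨hi, hj⟩ := isCell_gridIndex.1 hc
  rw [pt_completion Q hc.1, pt_completion Q hc.2.1, pt_completion Q hc.2.2.1,
    pt_completion Q hc.2.2.2]
  exact convexQuad_iff.2 ⟨_, _, faceParam_completion hQ hi hj (hg i hi j hj)⟩

theorem param_completion (hQ : IsNet Q) (hg : NondegenerateCompletion Q) (hi : i < m)
    (hj : j < n) :
    rho (completion Q) i j = extRho Q i j ∧ sigma (completion Q) i j = extSigma Q i j := by
  have hc := isCell_gridIndex.2 ⟨hi, hj⟩
  have hf := faceParam_completion hQ hi hj (hg i hi j hj)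
  unfold rho sigma
  rw [pt_completion Q hc.1, pt_completion Q hc.2.1, pt_completion Q hc.2.2.1,
    pt_completion Q hc.2.2.2]
  exact ⟨hf.rhoOf_eq, hf.sigma_eq⟩

theorem continuousAt_rho (hQ : IsNet Q) (h : IsCell (lIndex m n) i j) :
    ContinuousAt (fun Q : lIndex m n → E d => rho Q i j) Q :=
  continuousAt_rhoOf (continuousAt_pt continuousAt_id _ _) (continuousAt_pt continuousAt_id _ _)
    (continuousAt_pt continuousAt_id _ _) (continuousAt_pt continuousAt_id _ _) (hQ.faceParam h)

theorem continuousAt_sigma (hQ : IsNet Q) (h : IsCell (lIndex m n) i j) :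
    ContinuousAt (fun Q : lIndex m n → E d => sigma Q i j) Q :=
  continuousAt_rhoOf (continuousAt_pt continuousAt_id _ _) (continuousAt_pt continuousAt_id _ _)
    (continuousAt_pt continuousAt_id _ _) (continuousAt_pt continuousAt_id _ _)
    (hQ.faceParam h).swap

theorem continuousAt_extRho (hQ : IsNet Q) (hi : i < m) (hj : j < n) :
    ContinuousAt (fun Q : lIndex m n → E d => extRho Q i j) Q := by
  have c0 : IsCell (lIndex m n) 0 0 := isCell_row (by omega) (by omega)
  have c1 : IsCell (lIndex m n) i 0 := isCell_row hi (by omega)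
  have c2 : IsCell (lIndex m n) 0 j := isCell_col (by omega) hj
  exact (continuousAt_rho hQ c2).mul (continuousAt_alt ((continuousAt_rho hQ c1).div
    (continuousAt_rho hQ c0) (hQ.faceParam c0).rho_pos.ne')
    (div_pos (hQ.faceParam c1).rho_pos (hQ.faceParam c0).rho_pos).ne' j)

theorem continuousAt_extSigma (hQ : IsNet Q) (hi : i < m) (hj : j < n) :
    ContinuousAt (fun Q : lIndex m n → E d => extSigma Q i j) Q := by
  have c0 : IsCell (lIndex m n) 0 0 := isCell_row (by omega) (by omega)
  have c1 : IsCell (lIndex m n) i 0 := isCell_row hi (by omega)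
  have c2 : IsCell (lIndex m n) 0 j := isCell_col (by omega) hj
  exact (continuousAt_sigma hQ c1).mul (continuousAt_alt ((continuousAt_sigma hQ c2).div
    (continuousAt_sigma hQ c0) (hQ.faceParam c0).sigma_pos.ne')
    (div_pos (hQ.faceParam c2).sigma_pos (hQ.faceParam c0).sigma_pos).ne' i)

theorem continuousAt_extPt (hQ : IsNet Q) (hi : i ≤ m) (hj : j ≤ n) :
    ContinuousAt (fun Q : lIndex m n → E d => extPt Q i j) Q := by
  -- On the `L` the points are coordinates of `Q`; elsewhere they are obtained from continuous
  -- parameters with nonzero denominators.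
  have hL : ∀ i j, i ≤ 1 ∨ j ≤ 1 → ContinuousAt (fun Q : lIndex m n → E d => extPt Q i j) Q := by
    intro i j hij
    simp only [extPt_of_le _ hij]
    exact continuousAt_pt continuousAt_id i j
  induction i generalizing j with
  | zero => exact hL 0 j (Or.inl (by omega))
  | succ i ihi =>
    induction j with
    | zero => exact hL (i + 1) 0 (Or.inr (by omega))
    | succ j ihj =>
      by_cases hij : i = 0 ∨ j = 0
      · exact hL _ _ (by omega)
      · simp only [extPt_succ_succ _ hij]
        have h1 := ihi (j := j) (by omega) (by omega)
        have h2 := ihi (j := j + 1) (by omega) hj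
        have h3 := ihj (by omega)
        have h4 := continuousAt_extRho hQ (show i < m by omega) (show j < n by omega)
        have h5 := continuousAt_extSigma hQ (show i < m by omega) (show j < n by omega)
        have h6 := (add_pos (extRho_pos hQ (show i < m by omega) (show j < n by omega))
          (extSigma_pos hQ (show i < m by omega) (show j < n by omega))).ne'
        have h7 := continuousAt_const (y := (1 : ℝ)).add (h4.mul h5)
        exact h1.add ((((h7.mul h4).div (h4.add h5) h6).smul (h3.sub h1)).add
          (((h7.mul h5).div (h4.add h5) h6).smul (h2.sub h1)))

theorem continuousAt_completion (hQ : IsNet Q) :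
    ContinuousAt (completion : (lIndex m n → E d) → gridIndex m n → E d) Q :=
  continuousAt_pi.2 fun p => continuousAt_extPt hQ p.2.1 p.2.2

theorem NondegenerateCompletion.eventually (hQ : IsNet Q) (hg : NondegenerateCompletion Q) :
    ∀ᶠ Q' in 𝓝 Q, NondegenerateCompletion Q' := by
  refine eventually_forall_lt_lt fun i hi j hj => ?_
  have h0 := continuousAt_extPt hQ hi.le hj.le
  exact (continuousAt_gramDet ((continuousAt_extPt hQ (show i + 1 ≤ m from hi) hj.le).sub h0)
    ((continuousAt_extPt hQ hi.le (show j + 1 ≤ n from hj)).sub h0)).eventually_const_lt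
    (hg i hi j hj)

end Completion

/-! ### The two conditions in terms of the parameters -/

section Conditions

variable {d m n : ℕ} {A B C D X Y : E d} {ρ σ ρ' σ' : ℝ}

/-- The relation defining the parameters is linear in the sides, hence preserved by the affine map.
After relabelling the first face from the common side, its parameters are `ρ⁻¹, σ`. -/
theorem AffineSymmetric.param_eq (h : AffineSymmetric D C B A X Y) (h1 : FaceParam A B C D ρ σ)
    (h2 : FaceParam D C X Y ρ' σ') : ρ' = ρ⁻¹ ∧ σ' = σ := by
  obtain ⟨f, hD, hC, hB, hA⟩ := h
  have h3 := h1.reflect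
  have hf : ∀ p q : E d, f.linear (p - q) = f p - f q := fun p q => f.linearMap_vsub p q
  have h4 : FaceParam D C X Y ρ⁻¹ σ := by
    refine ⟨h3.rho_pos, h3.sigma_pos, h2.gram_pos, ?_⟩
    have := congrArg f.linear h3.rel
    rwa [map_add, map_smul, map_smul, map_smul, hf, hf, hf, hD, hC, hB, hA] at this
  exact ⟨h2.rhoOf_eq.symm.trans h4.rhoOf_eq, h2.sigma_eq.symm.trans h4.sigma_eq⟩

theorem EqualOppositeRatios.rho_eq (h : EqualOppositeRatios D C B A X Y)
    (h1 : FaceParam A B C D ρ σ) (h2 : FaceParam D C X Y ρ' σ') : ρ' = ρ⁻¹ := by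
  obtain ⟨r, hr1, hr2⟩ := h
  have e1 := h1.reflect.eq_of_isOppositeRatio hr1
  rw [h2.eq_of_isOppositeRatio hr2] at e1
  have h3 := h1.reflect.rho_pos
  have h4 := h2.rho_pos
  have : ρ' ^ 2 = ρ⁻¹ ^ 2 := by
    have := congrArg (fun x => x⁻¹) e1
    simpa only [one_div, inv_inv] using this
  exact (pow_left_inj₀ h4.le h3.le two_ne_zero).1 this

variable {Q : lIndex m n → E d}

theorem eq_alt_of_succ {a : ℕ → ℝ} {N : ℕ} (h : ∀ k, k + 1 < N → a (k + 1) = (a k)⁻¹) :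
    ∀ k < N, a k = alt (a 0) k := by
  intro k hk
  induction k with
  | zero => rw [alt_zero]
  | succ k ih => rw [h k hk, ih (by omega), alt_succ]

theorem eq_zero_of_succ {a : ℕ → ℝ} {N : ℕ} (h : ∀ k, k + 1 < N → a (k + 1) = a k) :
    ∀ k < N, a k = a 0 := by
  intro k hk
  induction k with
  | zero => rfl
  | succ k ih => rw [h k hk, ih (by omega)]

theorem alt_mul_alt_div {a b : ℝ} (ha : a ≠ 0) (j : ℕ) : alt a j * alt (b / a) j = alt b j := by
  rw [← alt_mul, mul_div_cancel₀ _ ha]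

/-- Under each condition, the extended parameters reduce to one of the three patterns above:
alternating `ρ` with constant `σ` in `j`, constant `ρ` with alternating `σ` in `i`, or both
alternating. -/
theorem isDeformable_completion (hm : 1 ≤ m) (hn : 1 ≤ n) (hQ : IsNet Q)
    (hg : NondegenerateCompletion Q) (hcond : CondI Q ∨ CondII Q) :
    IsDeformable (completion Q) := by
  have hN := isNet_completion hQ hg
  have hrow : ∀ i < m, FaceParam _ _ _ _ _ _ := fun i hi => hQ.faceParam (isCell_row hi hn)
  have hcol : ∀ j < n, FaceParam _ _ _ _ _ _ := fun j hj => hQ.faceParam (isCell_col hm hj)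
  have hρ0 := (hrow 0 hm).rho_pos.ne'
  have hσ0 := (hrow 0 hm).sigma_pos.ne'
  rcases hcond with (h | h) | ⟨h, h'⟩
  · have key : ∀ j, j + 1 < n → rho Q 0 (j + 1) = (rho Q 0 j)⁻¹ ∧
        sigma Q 0 (j + 1) = sigma Q 0 j := fun j hj => by
      have hs := h 0 j (isCell_col hm (by omega)) (isCell_col hm hj)
      simp only [v00_eq, v10_eq, v11_eq, v01_eq] at hs
      exact hs.param_eq (hcol j (by omega)) (hcol (j + 1) hj)
    have e1 := eq_alt_of_succ (a := rho Q 0) fun j hj => (key j hj).1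
    have e2 := eq_zero_of_succ (a := sigma Q 0) fun j hj => (key j hj).2
    refine isDeformable_of_affineSymmetric_vert hm hn hN (r := fun i => rho Q i 0)
      -- The value `1` beyond the net is harmless but must be nonzero: index `m` is used for the
      -- right edges of the last strip.
      (s := fun i => if i < m then sigma Q i 0 else 1) (fun i => ?_) fun i hi j hj => ?_
    · split_ifs with hi
      · exact (hrow i hi).sigma_pos.ne'
      · exact one_ne_zero
    · obtain ⟨p1, p2⟩ := param_completion hQ hg hi hj
      rw [p1, p2, extRho, extSigma, e1 j hj, e2 j hj, div_self hσ0, alt_one, mul_one,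
        alt_mul_alt_div hρ0, if_pos hi]
      exact ⟨rfl, rfl⟩
  · have key : ∀ i, i + 1 < m → sigma Q (i + 1) 0 = (sigma Q i 0)⁻¹ ∧
        rho Q (i + 1) 0 = rho Q i 0 := fun i hi => by
      have hs := h i 0 (isCell_row (by omega) hn) (isCell_row hi hn)
      simp only [v00_eq, v10_eq, v11_eq, v01_eq] at hs
      exact hs.param_eq (hrow i (by omega)).swap (hrow (i + 1) hi).swap
    have e1 := eq_alt_of_succ (a := fun i => sigma Q i 0) fun i hi => (key i hi).1
    have e2 := eq_zero_of_succ (a := fun i => rho Q i 0) fun i hi => (key i hi).2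
    refine isDeformable_of_affineSymmetric_horiz hm hn hN
      (r := fun j => if j < n then rho Q 0 j else 1) (s := fun j => sigma Q 0 j) (fun j => ?_)
      fun i hi j hj => ?_
    · split_ifs with hj
      · exact (hcol j hj).rho_pos.ne'
      · exact one_ne_zero
    · obtain ⟨p1, p2⟩ := param_completion hQ hg hi hj
      rw [p1, p2, extRho, extSigma, e1 i hi, e2 i hi, div_self hρ0, alt_one, mul_one,
        alt_mul_alt_div hσ0, if_pos hj]
      exact ⟨rfl, rfl⟩
  · have k1 : ∀ j, j + 1 < n → rho Q 0 (j + 1) = (rho Q 0 j)⁻¹ := fun j hj => by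
      have hs := h 0 j (isCell_col hm (by omega)) (isCell_col hm hj)
      simp only [v00_eq, v10_eq, v11_eq, v01_eq] at hs
      exact hs.rho_eq (hcol j (by omega)) (hcol (j + 1) hj)
    have k2 : ∀ i, i + 1 < m → sigma Q (i + 1) 0 = (sigma Q i 0)⁻¹ := fun i hi => by
      have hs := h' i 0 (isCell_row (by omega) hn) (isCell_row hi hn)
      simp only [v00_eq, v10_eq, v11_eq, v01_eq] at hs
      exact hs.rho_eq (hrow i (by omega)).swap (hrow (i + 1) hi).swap
    have e1 := eq_alt_of_succ (a := rho Q 0) k1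
    have e2 := eq_alt_of_succ (a := fun i => sigma Q i 0) k2
    refine isDeformable_of_equalRatios hm hn hN (r := fun i => rho Q i 0)
      (s := fun j => sigma Q 0 j) fun i hi j hj => ?_
    obtain ⟨p1, p2⟩ := param_completion hQ hg hi hj
    rw [p1, p2, extRho, extSigma, e1 j hj, e2 i hi, alt_mul_alt_div hρ0, alt_mul_alt_div hσ0]
    exact ⟨rfl, rfl⟩

end Conditions

/-! ### Square nets -/

section Square

variable {d m n : ℕ} {A B C D X Y : E d}

theorem IsSquare.swap (h : IsSquare A B C D) : IsSquare A D C B := by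
  obtain ⟨h1, h2, h3, h4⟩ := h
  refine ⟨?_, ?_, h3.symm, ?_⟩
  · rintro rfl
    rw [dist_self] at h3
    exact h1 (dist_eq_zero.1 h3)
  · rw [sub_eq_sub_iff_add_eq_add] at h2 ⊢
    rw [add_comm, h2, add_comm]
  · rw [real_inner_comm]
    exact h4

theorem IsSquare.norm_eq (h : IsSquare A B C D) : ‖B - A‖ = ‖D - A‖ := by
  rw [← dist_eq_norm', ← dist_eq_norm', h.2.2.1]

theorem IsSquare.gramDet_pos (h : IsSquare A B C D) : 0 < gramDet (B - A) (D - A) := by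
  have h0 : 0 < ‖B - A‖ := norm_pos_iff.2 (sub_ne_zero.2 h.1.symm)
  rw [gramDet, h.2.2.2, ← h.norm_eq, zero_pow two_ne_zero, sub_zero]
  positivity

theorem exists_comb_of_finrank_le_two {V : Submodule ℝ (E d)} (hV : Module.finrank ℝ V ≤ 2)
    {u v w : E d} (hu : u ∈ V) (hv : v ∈ V) (hw : w ∈ V) (hg : 0 < gramDet u v) :
    ∃ a b : ℝ, a • u + b • v = w := by
  have hli := (linearIndependent_iff_gramDet_pos u v).2 hg
  have hspan : Submodule.span ℝ (Set.range ![u, v]) = V := by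
    apply Submodule.eq_of_le_of_finrank_le
    · rw [Submodule.span_le]
      rintro _ ⟨i, rfl⟩
      fin_cases i <;> assumption
    · rw [finrank_span_eq_card hli]
      simpa using hV
  rw [← hspan, Matrix.range_cons, Matrix.range_cons, Matrix.range_empty, Set.union_empty,
    Set.singleton_union, Submodule.mem_span_pair] at hw
  exact hw

/-- Two coplanar squares with a common side are symmetric in this side, or coincide. -/
theorem IsSquare.next {V : Submodule ℝ (E d)} (hV : Module.finrank ℝ V ≤ 2)
    (h : IsSquare A B C D) (h' : IsSquare B X Y C) (hB : B - A ∈ V) (hD : D - A ∈ V)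
    (hX : X - B ∈ V) : X - B = B - A ∧ C - B = D - A ∨ X = A ∧ Y = D := by
  have hCB : C - B = D - A := h.swap.2.1.symm
  -- In the plane of the first square, orthogonality to the common side kills the component `b`, and
  -- equality of lengths gives `a = ±1`: continuation or folding back.
  obtain ⟨a, b, hab⟩ := exists_comb_of_finrank_le_two hV hB hD hX h.gramDet_pos
  have h1 := h'.2.2.2
  have h2 := h'.norm_eq
  have h3 := h.2.2.2
  have h4 := h.norm_eq
  rw [hCB, ← hab, inner_add_left, real_inner_smul_left, real_inner_smul_left, h3, mul_zero,
    zero_add, real_inner_self_eq_norm_sq, ← h4] at h1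
  have h0 : 0 < ‖B - A‖ := norm_pos_iff.2 (sub_ne_zero.2 h.1.symm)
  have hb : b = 0 := by
    rcases mul_eq_zero.1 h1 with h | h
    · exact h
    · exact absurd h (by positivity)
  rw [hb, zero_smul, add_zero] at hab
  rw [hCB, ← hab, norm_smul, ← h4, mul_eq_right₀ h0.ne', Real.norm_eq_abs] at h2
  rcases eq_or_eq_neg_of_abs_eq h2 with ha | ha
  · left
    rw [ha, one_smul] at hab
    exact ⟨hab.symm, hCB⟩
  · right
    have hXA : X = A := by
      rw [ha, neg_one_smul, neg_sub] at hab
      exact (sub_left_inj.1 hab).symm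
    refine ⟨hXA, ?_⟩
    have h5 := h'.2.1
    have h6 := h.2.1
    rw [hXA] at h5
    have : Y - C = D - C := by rw [← h5, ← neg_sub B A, h6, neg_sub]
    exact sub_left_inj.1 this

variable {S : lIndex m n → E d}

/-- A square net is the `L`-shaped part of a square grid. -/
theorem IsSquareNet.exists_grid (hm : 1 ≤ m) (hn : 1 ≤ n) (hS : IsSquareNet S) :
    ∃ o e f : E d, 0 < gramDet e f ∧ ∀ i j, (i, j) ∈ lIndex m n →
      pt S i j = o + ((i : ℝ) • e + (j : ℝ) • f) := by
  obtain ⟨-, hcop, hsq, hne⟩ := hS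
  rw [coplanar_iff_finrank_le_two] at hcop
  set V := vectorSpan ℝ (Set.range S) with hVdef
  have hmem : ∀ i j i' j', (i, j) ∈ lIndex m n → (i', j') ∈ lIndex m n →
      pt S i j - pt S i' j' ∈ V := by
    intro i j i' j' h h'
    rw [pt_of_mem S h, pt_of_mem S h']
    exact vsub_mem_vectorSpan ℝ (Set.mem_range_self _) (Set.mem_range_self _)
  have hsq' : ∀ i j, IsCell (lIndex m n) i j →
      IsSquare (pt S i j) (pt S (i + 1) j) (pt S (i + 1) (j + 1)) (pt S i (j + 1)) := by
    intro i j h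
    have := hsq i j h
    rwa [v00_eq, v10_eq, v11_eq, v01_eq] at this
  have hface : ∀ i j i' j', IsCell (lIndex m n) i j → IsCell (lIndex m n) i' j' →
      (i, j) ≠ (i', j') →
      ({pt S i j, pt S (i + 1) j, pt S (i + 1) (j + 1), pt S i (j + 1)} : Set (E d)) ≠
        {pt S i' j', pt S (i' + 1) j', pt S (i' + 1) (j' + 1), pt S i' (j' + 1)} := by
    intro i j i' j' h h' hij heq
    apply hne i j i' j' h h' hij
    rw [faceSet, faceSet, v00_eq, v10_eq, v11_eq, v01_eq, v00_eq, v10_eq, v11_eq, v01_eq, heq]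
  set o := pt S 0 0
  set e := pt S 1 0 - pt S 0 0 with he
  set f := pt S 0 1 - pt S 0 0 with hf
  have hg : 0 < gramDet e f := (hsq' 0 0 (isCell_row hm hn)).gramDet_pos
  have hrow : ∀ i < m, pt S (i + 1) 0 - pt S i 0 = e ∧ pt S i 1 - pt S i 0 = f := by
    intro i hi
    induction i with
    | zero => exact ⟨rfl, rfl⟩
    | succ i ih =>
      obtain ⟨h1, h2⟩ := ih (by omega)
      have c1 : IsCell (lIndex m n) i 0 := isCell_row (by omega) hn
      have c2 : IsCell (lIndex m n) (i + 1) 0 := isCell_row hi hn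
      rcases (hsq' i 0 c1).next hcop (hsq' (i + 1) 0 c2) (hmem _ _ _ _ c1.2.1 c1.1)
        (hmem _ _ _ _ c1.2.2.2 c1.1) (hmem _ _ _ _ c2.2.1 c2.1) with ⟨h3, h4⟩ | ⟨h3, h4⟩
      · exact ⟨h3.trans h1, h4.trans h2⟩
      -- A square folded back has the same vertices as the preceding one, which is excluded.
      · exfalso
        apply hface i 0 (i + 1) 0 c1 c2 (by simp)
        rw [h3, h4]
        ext x
        simp only [Set.mem_insert_iff, Set.mem_singleton_iff]
        tauto
  have hcol : ∀ j < n, pt S 0 (j + 1) - pt S 0 j = f ∧ pt S 1 j - pt S 0 j = e := by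
    intro j hj
    induction j with
    | zero => exact ⟨rfl, rfl⟩
    | succ j ih =>
      obtain ⟨h1, h2⟩ := ih (by omega)
      have c1 : IsCell (lIndex m n) 0 j := isCell_col hm (by omega)
      have c2 : IsCell (lIndex m n) 0 (j + 1) := isCell_col hm hj
      rcases (hsq' 0 j c1).swap.next hcop (hsq' 0 (j + 1) c2).swap (hmem _ _ _ _ c1.2.2.2 c1.1)
        (hmem _ _ _ _ c1.2.1 c1.1) (hmem _ _ _ _ c2.2.2.2 c2.1) with ⟨h3, h4⟩ | ⟨h3, h4⟩
      · exact ⟨h3.trans h1, h4.trans h2⟩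
      · exfalso
        apply hface 0 j 0 (j + 1) c1 c2 (by simp)
        rw [h3, h4]
        ext x
        simp only [Set.mem_insert_iff, Set.mem_singleton_iff]
        tauto
  refine ⟨o, e, f, hg, ?_⟩
  have r0 : ∀ i ≤ m, pt S i 0 = o + (i : ℝ) • e := by
    intro i hi
    induction i with
    | zero => simp [o]
    | succ i ih =>
      rw [← sub_add_cancel (pt S (i + 1) 0) (pt S i 0), (hrow i (by omega)).1, ih (by omega)]
      push_cast
      module
  have c0 : ∀ j ≤ n, pt S 0 j = o + (j : ℝ) • f := by
    intro j hj
    induction j with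
    | zero => simp [o]
    | succ j ih =>
      rw [← sub_add_cancel (pt S 0 (j + 1)) (pt S 0 j), (hcol j (by omega)).1, ih (by omega)]
      push_cast
      module
  have r1 : ∀ i ≤ m, pt S i 1 = pt S i 0 + f := by
    intro i hi
    rcases Nat.lt_or_ge i m with him | him
    · rw [← (hrow i him).2]; abel
    · obtain ⟨k, rfl⟩ : ∃ k, i = k + 1 := ⟨i - 1, by omega⟩
      have hk : k < m := by omega
      rw [← (hrow k hk).2, (hsq' k 0 (isCell_row hk hn)).swap.2.1]
      abel
  have c1 : ∀ j ≤ n, pt S 1 j = pt S 0 j + e := by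
    intro j hj
    rcases Nat.lt_or_ge j n with hjn | hjn
    · rw [← (hcol j hjn).2]; abel
    · obtain ⟨k, rfl⟩ : ∃ k, j = k + 1 := ⟨j - 1, by omega⟩
      have hk : k < n := by omega
      rw [← (hcol k hk).2, (hsq' 0 k (isCell_col hm hk)).2.1]
      abel
  intro i j hij
  obtain ⟨hi, hj, hij⟩ := mem_lIndex.1 hij
  have hcases : j = 0 ∨ j = 1 ∨ i = 0 ∨ i = 1 := by omega
  rcases hcases with rfl | rfl | rfl | rfl
  · rw [r0 i hi]; simp
  · rw [r1 i hi, r0 i hi]; push_cast; module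
  · rw [c0 j hj]; simp
  · rw [c1 j hj, c0 j hj]; push_cast; module

/-- All parameters are `1`, so every new face is a parallelogram and the completion is the full grid
spanned by `e` and `f`. -/
theorem IsSquareNet.nondegenerateCompletion (hm : 1 ≤ m) (hn : 1 ≤ n) (hS : IsSquareNet S) :
    NondegenerateCompletion S := by
  obtain ⟨o, e, f, hg, hpt⟩ := hS.exists_grid hm hn
  have hparam : ∀ i j, IsCell (lIndex m n) i j → rho S i j = 1 ∧ sigma S i j = 1 := by
    intro i j hc
    have hfp : FaceParam (pt S i j) (pt S (i + 1) j) (pt S (i + 1) (j + 1)) (pt S i (j + 1))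
        1 1 := by
      rw [hpt _ _ hc.1, hpt _ _ hc.2.1, hpt _ _ hc.2.2.1, hpt _ _ hc.2.2.2]
      refine ⟨one_pos, one_pos, ?_, ?_⟩
      · convert hg using 2 <;> push_cast <;> module
      · push_cast
        module
    exact ⟨hfp.rhoOf_eq, hfp.sigma_eq⟩
  have hext : ∀ i < m, ∀ j < n, extRho S i j = 1 ∧ extSigma S i j = 1 := by
    intro i hi j hj
    rw [extRho, extSigma, (hparam _ _ (isCell_row hm hn)).1, (hparam _ _ (isCell_row hm hn)).2,
      (hparam _ _ (isCell_row hi hn)).1, (hparam _ _ (isCell_row hi hn)).2,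
      (hparam _ _ (isCell_col hm hj)).1, (hparam _ _ (isCell_col hm hj)).2]
    simp [alt_one]
  have hgrid : ∀ i ≤ m, ∀ j ≤ n, extPt S i j = o + ((i : ℝ) • e + (j : ℝ) • f) := by
    intro i
    induction i with
    | zero =>
      intro hi j hj
      rw [extPt_of_le S (by omega), hpt 0 j (mem_lIndex.2 ⟨hi, hj, by omega⟩)]
    | succ i ihi =>
      intro hi j
      induction j with
      | zero =>
        intro hj
        rw [extPt_of_le S (by omega), hpt (i + 1) 0 (mem_lIndex.2 ⟨hi, hj, by omega⟩)]
      | succ j ihj =>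
        intro hj
        by_cases hij : i = 0 ∨ j = 0
        · rw [extPt_of_le S (by omega), hpt _ _ (mem_lIndex.2 ⟨hi, hj, by omega⟩)]
        · rw [extPt_succ_succ S hij, (hext i (by omega) j (by omega)).1,
            (hext i (by omega) j (by omega)).2, ihi (by omega) j (by omega),
            ihi (by omega) (j + 1) hj, ihj (by omega)]
          push_cast
          module
  intro i hi j hj
  rw [hgrid i hi.le j hj.le, hgrid (i + 1) hi j hj.le, hgrid i hi.le (j + 1) hj]
  convert hg using 2 <;> push_cast <;> module

end Square

/-! ### Proof of the corollary -/

theorem finite_lIndex (m n : ℕ) : (lIndex m n).Finite :=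
  ((Set.finite_Iic m).prod (Set.finite_Iic n)).subset fun _ hp => ⟨hp.1, hp.2.1⟩

end LNet

theorem corollary3p2 (d m n : ℕ) (hm : 1 ≤ m) (hn : 1 ≤ n)
    (S : LNet.lIndex m n → LNet.E d) (hS : LNet.IsSquareNet S) :
    ∃ ε : ℝ, 0 < ε ∧
      (∀ Q ∈ LNet.admissible S ε,
        ∃! P : LNet.gridIndex m n → LNet.E d,
          LNet.IsNet P ∧ LNet.IsDeformable P ∧ LNet.lPart P = Q) ∧
      ∃ Φ : (LNet.lIndex m n → LNet.E d) → (LNet.gridIndex m n → LNet.E d),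
        (∀ Q ∈ LNet.admissible S ε,
          LNet.IsNet (Φ Q) ∧ LNet.IsDeformable (Φ Q) ∧ LNet.lPart (Φ Q) = Q) ∧
        ContinuousOn Φ (LNet.admissible S ε) := by
  -- Finiteness of the index set makes closeness of all points a ball in the sup metric.
  have : Fintype (LNet.lIndex m n) := (LNet.finite_lIndex m n).fintype
  -- The number `ε` only has to keep the completion nondegenerate; this is the sole use of closeness
  -- to `S`.
  obtain ⟨ε, hε, hball⟩ := Metric.eventually_nhds_iff.1
    ((hS.nondegenerateCompletion hm hn).eventually hS.1)
  have hΦ : ∀ Q ∈ LNet.admissible S ε, LNet.IsNet (LNet.completion Q) ∧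
      LNet.IsDeformable (LNet.completion Q) ∧ LNet.lPart (LNet.completion Q) = Q := by
    rintro Q ⟨hQ, hdist, hcond⟩
    have hg := hball ((dist_pi_lt_iff hε).2 hdist)
    exact ⟨LNet.isNet_completion hQ hg, LNet.isDeformable_completion hm hn hQ hg hcond,
      LNet.lPart_completion Q⟩
  refine ⟨ε, hε, fun Q hQ => ⟨LNet.completion Q, hΦ Q hQ, ?_⟩, LNet.completion, hΦ, ?_⟩
  · rintro P ⟨hP, hd, hL⟩
    obtain ⟨h1, h2, h3⟩ := hΦ Q hQ
    exact hd.eq_of_lPart_eq hm hn hP h1 h2 (hL.trans h3.symm)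
  · exact fun Q hQ => (LNet.continuousAt_completion hQ.1).continuousWithinAt
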